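/- Let $M=(\Gamma\times\mathbb Z)\backslash(\mathrm{Nil}^3\times\mathbb R)$ be the Kodaira–Thurston surface, where $\mathrm{Nil}^3$ is the real Heisenberg group of upper unitriangular $3\times3$ matrices with entries $x$ at place $(1,2)$, $y$ at $(2,3)$, $z$ at $(1,3)$, $\Gamma$ is its lattice of integer matrices, and $w$ is the coordinate on $\mathbb R$. Thus tensor fields on $M$ are the tensor fields on $\mathbb R^4$ invariant under $(x,y,z,w)\mapsto(x+j,\,y+k,\,z+jy+m,\,w+n)$, $j,k,m,n\in\mathbb Z$. Put $e^1=dy$, $e^2=dx$, $e^3=dw$, $e^4=dz-x\,dy$ and $e^{ij}=e^i\wedge e^j$; the complex structure acts on 1-forms by $Je^1=e^2$, $Je^3=e^4$, with $e^1+ie^2$ and $e^3+ie^4$ of type $(1,0)$. Write $d^cu=J\,du$ and $\Delta u=u_{xx}+u_{yy}$. A form is $T^2$-invariant if its coefficients in the basis of products of the $e^i$ do not depend on $z,w$. A Vaisman structure $(\omega,\theta)$ on $(M,J)$ consists of the fundamental form $\omega$ of a Hermitian metric $g$ and a closed 1-form $\theta$ (the Lee form), parallel for the Levi-Civita connection of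 $g$, with $d\omega=\theta\wedge\omega$; it is normalized if $|\theta|_g=1$. Given a Vaisman structure $(\omega,\theta)$ with Lee vector field $T=\theta^\#$ and $f\in C^\infty(M)$ with $T(f)=JT(f)=0$, its deformation of type II by $f$ is $$\tilde\theta=\theta+df,\qquad \tilde\omega=|\theta|_g^2\,\omega+\theta\wedge J\,df+df\wedge J\theta+df\wedge J\,df-dd^cf,$$ provided that $\tilde\omega$ is positive. The Chern–Ricci form of a Hermitian metric is $-\tfrac12dd^c\log\det(g_{\alpha\bar\beta})$ in local holomorphic coordinates. 1. $\omega=e^{12}+e^{34}$ with $\theta=-e^3$ is a normalized $T^2$-invariant Vaisman structure on $M$. 2. Let $f=f(x,y)$ be a smooth function on $M$ with $1-f_{xx}-f_{yy}>0$. Then the deformation of type II of $(\omega,\theta)$ by $f$ is defined, and it is $$\tilde\omega=(1+f_x^2+f_y^2-f_{xx}-f_{yy})e^{12}+e^{34}-f_x(e^{13}+e^{24})-f_y(e^{14}-e^{23}),\qquad \tilde\theta=-e^3+f_ye^1+f_xe^2.$$ It is a normalized $T^2$-invariant Vaisman structure on $M$, with $$d(J\tilde\theta)=(-1+f_{xx}+f_{yy})\,e^{12},\qquad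 \tilde\rho^{Ch}=-\tfrac12\,\Delta\log(1-f_{xx}-f_{yy})\,e^{12}=h\,d(J\tilde\theta),$$ $$h=-\frac12\,\frac{1}{-1+f_{xx}+f_{yy}}\,\Delta\log(1-f_{xx}-f_{yy}),$$ where $\tilde\rho^{Ch}$ is the Chern–Ricci form of $\tilde\omega$. If $h$ is non-constant, then the (Riemannian) scalar curvature of $\tilde\omega$ is non-constant. 3. There is a function $f$ as in 2 for which $h$ is non-constant. Consequently there are $T^2$-invariant Vaisman metrics on $M$ with non-constant scalar curvature. -/

import Mathlib

noncomputable section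

namespace KodairaThurston

/-! ## The surface

The Kodaira-Thurston surface is `M = Γ \ Nil³ × S¹ = (Γ × ℤ) \ (Nil³ × ℝ)`.  Its universal cover
`Nil³ × ℝ` is identified with `ℝ⁴` through the global coordinates `(x, y, z, w)`, which are the
coordinates `0, 1, 2, 3` below.  Functions, differential forms and other tensor fields on `M` are
the tensor fields on the cover that are invariant under the deck group `Γ × ℤ`. -/

/-- The universal cover `Nil³ × ℝ` of `M`, in the coordinates `(x, y, z, w)`. -/
abbrev Cover : Type := Fin 4 → ℝ

/-- The elements of the Heisenberg group `Nil³`. -/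
def heis (x y z : ℝ) : Matrix (Fin 3) (Fin 3) ℝ := !![1, x, z; 0, 1, y; 0, 0, 1]

/-- The deck transformation
`(x, y, z, w) ↦ (x + j, y + k, z + j y + m, w + n)`. -/
def deck (j k m n : ℤ) (p : Cover) : Cover :=
  ![p 0 + j, p 1 + k, p 2 + j * p 1 + m, p 3 + n]

/-- On `Nil³`, deck transformations are the left translations by the lattice `Γ` of the integer
matrices in `Nil³`. -/
lemma heis_deck (j k m n : ℤ) (p : Cover) :
    heis (deck j k m n p 0) (deck j k m n p 1) (deck j k m n p 2) =
      heis j k m * heis (p 0) (p 1) (p 2) := by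
  ext a b
  fin_cases a <;> fin_cases b <;>
    simp [heis, deck, Matrix.mul_apply, Fin.sum_univ_three, add_comm, add_left_comm]

/-- `k`-forms on the cover. -/
abbrev Form (k : ℕ) : Type := Cover → Cover [⋀^Fin k]→L[ℝ] ℝ

/-- `u` is (the pullback to the cover of) a smooth function on `M`. -/
def IsFunctionOnM (u : Cover → ℝ) : Prop :=
  ContDiff ℝ (⊤ : ℕ∞) u ∧ ∀ (j k m n : ℤ) (p : Cover), u (deck j k m n p) = u p

/-- `α` is (the pullback to the cover of) a smooth `k`-form on `M`. -/
def IsFormOnM {k : ℕ} (α : Form k) : Prop :=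
  ContDiff ℝ (⊤ : ℕ∞) α ∧ ∀ (j l m n : ℤ) (p : Cover),
    (α (deck j l m n p)).compContinuousLinearMap (fderiv ℝ (deck j l m n) p) = α p

/-- The function does not depend on the fibre coordinates `z, w`: `u = u(x, y)`. -/
def DependsOnlyOnXY (u : Cover → ℝ) : Prop :=
  ∀ p q : Cover, p 0 = q 0 → p 1 = q 1 → u p = u q

/-! ## Exterior calculus -/

/-- The linear functional `v ↦ v i`, i.e. the value of `dx, dy, dz, dw` at any point. -/
def dcoord (i : Fin 4) : Cover →L[ℝ] ℝ := ContinuousLinearMap.proj i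

/-- A field of linear functionals, seen as a `1`-form. -/
def oneForm (α : Cover → Cover →L[ℝ] ℝ) : Form 1 :=
  fun p => ContinuousAlternatingMap.ofSubsingleton ℝ Cover ℝ (0 : Fin 1) (α p)

/-- The differential of a function. -/
def dfun (u : Cover → ℝ) : Form 1 := oneForm (fderiv ℝ u)

/-- The wedge product of a `1`-form with a `k`-form,
`(α ∧ β)(v₀, …, v_k) = ∑ᵢ (-1)ⁱ α(vᵢ) β(v₀, …, v̂ᵢ, …, v_k)`. -/
def wedge {k : ℕ} (α : Form 1) (β : Form k) : Form (k + 1) :=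
  fun p => ContinuousAlternatingMap.alternatizeUncurryFin
    (((ContinuousAlternatingMap.ofSubsingleton ℝ Cover ℝ (0 : Fin 1)).symm (α p)).smulRight (β p))

/-- The left-invariant coframe `e¹ = dy`, `e² = dx`, `e³ = dw`, `e⁴ = dz - x dy`. -/
def e1 : Form 1 := oneForm fun _ => dcoord 1
def e2 : Form 1 := oneForm fun _ => dcoord 0
def e3 : Form 1 := oneForm fun _ => dcoord 3
def e4 : Form 1 := oneForm fun p => dcoord 2 - p 0 • dcoord 1

/-- The dual frame `e₁ = ∂_y + x ∂_z`, `e₂ = ∂_x`, `e₃ = ∂_w`, `e₄ = ∂_z` (listed as `0, 1, 2, 3`). -/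
def frame (i : Fin 4) (p : Cover) : Cover :=
  (![![0, 1, p 0, 0], ![1, 0, 0, 0], ![0, 0, 0, 1], ![0, 0, 1, 0]] : Fin 4 → Cover) i

/-- A form is `T²`-invariant if its coefficients in the basis `e^{i₁} ∧ ⋯ ∧ e^{i_k}` do not depend
on the fibre coordinates `z, w`. -/
def IsT2Invariant {k : ℕ} (α : Form k) : Prop :=
  ∀ i : Fin k → Fin 4, DependsOnlyOnXY fun p => α p fun a => frame (i a) p

/-! ## The complex structure -/

/-- The complex structure on vectors: `J e₁ = e₂`, `J e₂ = -e₁`, `J e₃ = e₄`, `J e₄ = -e₃`. -/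
def J (p : Cover) : Cover →L[ℝ] Cover :=
  (dcoord 1).smulRight (frame 1 p) - (dcoord 0).smulRight (frame 0 p)
    + (dcoord 3).smulRight (frame 3 p) - (dcoord 2 - p 0 • dcoord 1).smulRight (frame 2 p)

/-- The complex structure on `1`-forms, `(Jα)(X) = -α(JX)`, so that `J e¹ = e²`, `J e³ = e⁴`. -/
def Jform (α : Form 1) : Form 1 := fun p => -(α p).compContinuousLinearMap (J p)

/-- `dd^c u`, where `d^c = -J⁻¹ d J`, so that `d^c u = J du` on functions. -/
def ddc (u : Cover → ℝ) : Form 2 := extDeriv (Jform (dfun u))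

/-- Local holomorphic coordinates `(ζ₁, ζ₂)` of `(M, J)` on an open subset of the cover, with the
real coordinate vector fields `X_a = ∂ / ∂ Re ζ_a`.  Then `∂ / ∂ζ_a = (X_a - i J X_a) / 2`. -/
structure HolomorphicChart where
  source : Set Cover
  isOpen_source : IsOpen source
  ζ : Fin 2 → Cover → ℂ
  smooth : ∀ a, ContDiffOn ℝ (⊤ : ℕ∞) (ζ a) source
  holomorphic : ∀ a, ∀ p ∈ source, ∀ v,
    fderiv ℝ (ζ a) p (J p v) = Complex.I * fderiv ℝ (ζ a) p v
  X : Fin 2 → Cover → Cover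
  dual : ∀ a b, ∀ p ∈ source, fderiv ℝ (ζ a) p (X b p) = if a = b then 1 else 0

/-- The complex coordinates `y + i x` and `w + i z - x² / 2` on the cover. -/
def zeta (a : Fin 2) (p : Cover) : ℂ :=
  (![(p 1 : ℂ) + (p 0 : ℂ) * Complex.I,
    ((p 3 - p 0 ^ 2 / 2 : ℝ) : ℂ) + (p 2 : ℂ) * Complex.I] : Fin 2 → ℂ) a

lemma hasFDerivAt_zeta0 (p : Cover) : HasFDerivAt (zeta 0)
    (Complex.ofRealCLM.comp (dcoord 1) + (Complex.ofRealCLM.comp (dcoord 0)).smulRight Complex.I)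
    p := by
  have h (i : Fin 4) : HasFDerivAt (fun p : Cover => ((p i : ℝ) : ℂ))
      (Complex.ofRealCLM.comp (dcoord i)) p :=
    (Complex.ofRealCLM.comp (dcoord i)).hasFDerivAt
  refine ((h 1).add ((h 0).mul_const Complex.I)).congr_fderiv ?_
  ext v <;> simp [mul_comm]

lemma hasFDerivAt_zeta1 (p : Cover) : HasFDerivAt (zeta 1)
    (Complex.ofRealCLM.comp (dcoord 3 - p 0 • dcoord 0)
      + (Complex.ofRealCLM.comp (dcoord 2)).smulRight Complex.I) p := by
  have h (i : Fin 4) : HasFDerivAt (fun p : Cover => p i) (dcoord i) p := (dcoord i).hasFDerivAt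
  have h1 : HasFDerivAt (fun p : Cover => p 3 - p 0 ^ 2 / 2) (dcoord 3 - p 0 • dcoord 0) p := by
    refine ((h 3).sub (((h 0).pow 2).mul_const (1 / 2))).congr_fderiv ?_ |>.congr_of_eventuallyEq ?_
    · ext v; simp; ring
    · filter_upwards with q
      simp; ring
  refine ((Complex.ofRealCLM.hasFDerivAt.comp p h1).add
    ((Complex.ofRealCLM.hasFDerivAt.comp p (h 2)).mul_const Complex.I)).congr_fderiv ?_
  ext v <;> simp [mul_comm]

/-- `y + i x` and `w + i z - x² / 2` are holomorphic coordinates on the whole cover. -/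
def universalChart : HolomorphicChart where
  source := Set.univ
  isOpen_source := isOpen_univ
  ζ := zeta
  smooth a := by
    have h (i : Fin 4) : ContDiff ℝ (⊤ : ℕ∞) fun p : Cover => p i := contDiff_apply ℝ ℝ i
    have h' (u : Cover → ℝ) (hu : ContDiff ℝ (⊤ : ℕ∞) u) : ContDiff ℝ (⊤ : ℕ∞) fun p => (u p : ℂ) :=
      Complex.ofRealCLM.contDiff.comp hu
    refine ContDiff.contDiffOn ?_
    fin_cases a
    · exact (h' _ (h 1)).add ((h' _ (h 0)).mul contDiff_const)
    · exact (h' _ ((h 3).sub (((h 0).pow 2).div_const 2))).add ((h' _ (h 2)).mul contDiff_const)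
  holomorphic a p _ v := by
    fin_cases a
    · simp only [Fin.zero_eta, (hasFDerivAt_zeta0 p).fderiv]
      apply Complex.ext <;> simp [J, frame, dcoord]
    · simp only [Fin.mk_one, (hasFDerivAt_zeta1 p).fderiv]
      apply Complex.ext <;> simp [J, frame, dcoord] <;> ring
  X a _ := (![Pi.single 1 1, Pi.single 3 1] : Fin 2 → Cover) a
  dual a b p _ := by
    fin_cases a <;> fin_cases b <;>
      simp [(hasFDerivAt_zeta0 p).fderiv, (hasFDerivAt_zeta1 p).fderiv, dcoord]

/-! ## Hermitian metrics -/

/-- The metric of a fundamental form, `g(X, Y) = ω(X, JY)`; equivalently `ω(X, Y) = g(JX, Y)`. -/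
def metric (ω : Form 2) (p : Cover) (X Y : Cover) : ℝ := ω p ![X, J p Y]

/-- `ω` is the fundamental form of a (smooth) Hermitian metric on `(M, J)`. -/
structure IsFundamentalForm (ω : Form 2) : Prop where
  isFormOnM : IsFormOnM ω
  J_invariant : ∀ p X Y, ω p ![J p X, J p Y] = ω p ![X, Y]
  positive : ∀ p X, X ≠ 0 → 0 < metric ω p X X

/-- The coordinate vectors `∂_x, ∂_y, ∂_z, ∂_w`. -/
def cvec (i : Fin 4) : Cover := Pi.single i 1

/-- The partial derivative in the `i`-th coordinate direction. -/
def pd (i : Fin 4) (u : Cover → ℝ) (p : Cover) : ℝ := fderiv ℝ u p (cvec i)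

/-- The coordinate matrix `g_{ij}`. -/
def gMat (ω : Form 2) (p : Cover) : Matrix (Fin 4) (Fin 4) ℝ :=
  Matrix.of fun i j => metric ω p (cvec i) (cvec j)

/-- The inverse matrix `g^{ij}`. -/
def gInv (ω : Form 2) (p : Cover) : Matrix (Fin 4) (Fin 4) ℝ := (gMat ω p)⁻¹

/-- The Christoffel symbols `Γ^k_{ij}` of the Levi-Civita connection. -/
def christoffel (ω : Form 2) (k i j : Fin 4) (p : Cover) : ℝ :=
  1 / 2 * ∑ l, gInv ω p k l *
    (pd i (fun q => gMat ω q j l) p + pd j (fun q => gMat ω q i l) p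
      - pd l (fun q => gMat ω q i j) p)

/-- The Ricci tensor of the Levi-Civita connection,
`Ric_{jk} = ∂_i Γ^i_{jk} - ∂_j Γ^i_{ik} + Γ^i_{im} Γ^m_{jk} - Γ^i_{jm} Γ^m_{ik}`. -/
def ricci (ω : Form 2) (j k : Fin 4) (p : Cover) : ℝ :=
  ∑ i, (pd i (christoffel ω i j k) p - pd j (christoffel ω i i k) p
    + ∑ m, (christoffel ω i i m p * christoffel ω m j k p
      - christoffel ω i j m p * christoffel ω m i k p))

/-- The (Riemannian) scalar curvature `g^{jk} Ric_{jk}`. -/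
def scalarCurvature (ω : Form 2) (p : Cover) : ℝ :=
  ∑ j, ∑ k, gInv ω p j k * ricci ω j k p

/-- The components `θ_i` of a `1`-form in the coordinates `(x, y, z, w)`. -/
def comp (θ : Form 1) (i : Fin 4) (p : Cover) : ℝ := θ p ![cvec i]

/-- `∇θ = 0` for the Levi-Civita connection of the metric. -/
def IsParallel (ω : Form 2) (θ : Form 1) : Prop :=
  ∀ i j p, pd i (comp θ j) p - ∑ k, christoffel ω k i j p * comp θ k p = 0

/-- `|θ|²` with respect to the metric. -/
def normSq (ω : Form 2) (θ : Form 1) (p : Cover) : ℝ :=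
  ∑ i, ∑ j, gInv ω p i j * comp θ i p * comp θ j p

/-- The metric dual `θ^#`; for a Lee form, the Lee vector field. -/
def sharp (ω : Form 2) (θ : Form 1) (p : Cover) : Cover :=
  fun i => ∑ j, gInv ω p i j * comp θ j p

/-- `ω` is the fundamental form of a Vaisman metric on `(M, J)` with Lee form `θ`. -/
structure IsVaisman (ω : Form 2) (θ : Form 1) : Prop where
  isFundamentalForm : IsFundamentalForm ω
  isFormOnM : IsFormOnM θ
  closed : ∀ p, extDeriv θ p = 0
  lee : ∀ p, extDeriv ω p = wedge θ ω p
  parallel : IsParallel ω θ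

/-- A normalized Vaisman structure: the Lee form has norm `1`. -/
def IsNormalizedVaisman (ω : Form 2) (θ : Form 1) : Prop :=
  IsVaisman ω θ ∧ ∀ p, normSq ω θ p = 1

/-- The matrix `g(∂/∂ζ_a, ∂/∂ζ̄_b) = (g(X_a, X_b) + i g(X_a, J X_b)) / 2` of the metric in local
holomorphic coordinates. -/
def hermMat (ω : Form 2) (c : HolomorphicChart) (p : Cover) : Matrix (Fin 2) (Fin 2) ℂ :=
  Matrix.of fun a b =>
    ((metric ω p (c.X a p) (c.X b p) : ℂ)
      + Complex.I * (metric ω p (c.X a p) (J p (c.X b p)) : ℂ)) / 2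

/-- `ρ` is the Chern-Ricci form of the metric:
`ρ = -i ∂∂̄ log det(g_{ab̄}) = -1/2 dd^c log det(g_{ab̄})` in all local holomorphic coordinates. -/
def IsChernRicciForm (ω ρ : Form 2) : Prop :=
  ∀ c : HolomorphicChart, ∀ p ∈ c.source,
    ρ p = (-(1 / 2) : ℝ) • ddc (fun q => Real.log (hermMat ω c q).det.re) p

/-! ## Deformations of type II -/

/-- `θ + df`. -/
def deformedLee (θ : Form 1) (f : Cover → ℝ) : Form 1 := θ + dfun f

/-- `|θ|² ω + θ ∧ J df + df ∧ Jθ + df ∧ J df - dd^c f`. -/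
def deformedForm (ω : Form 2) (θ : Form 1) (f : Cover → ℝ) : Form 2 := fun p =>
  normSq ω θ p • ω p + wedge θ (Jform (dfun f)) p + wedge (dfun f) (Jform θ) p
    + wedge (dfun f) (Jform (dfun f)) p - ddc f p

/-- `(ω', θ')` is the deformation of type II, by the function `f`, of the Vaisman structure
`(ω, θ)` with Lee vector field `T`. -/
structure IsTypeIIDeformation (ω : Form 2) (θ : Form 1) (f : Cover → ℝ) (ω' : Form 2)
    (θ' : Form 1) : Prop where
  isVaisman : IsVaisman ω θ
  isFunctionOnM : IsFunctionOnM f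
  T_apply : ∀ p, fderiv ℝ f p (sharp ω θ p) = 0
  JT_apply : ∀ p, fderiv ℝ f p (J p (sharp ω θ p)) = 0
  form_eq : ω' = deformedForm ω θ f
  lee_eq : θ' = deformedLee θ f
  positive : IsFundamentalForm ω'

/-! ## The data of the construction -/

/-- `ω = e¹² + e³⁴`. -/
def omega0 : Form 2 := wedge e1 e2 + wedge e3 e4

/-- `Δ u = u_xx + u_yy`. -/
def lap (u : Cover → ℝ) (p : Cover) : ℝ := pd 0 (pd 0 u) p + pd 1 (pd 1 u) p

/-- A function `f = f(x, y)` on `M` with `1 - f_xx - f_yy > 0`. -/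
structure IsAdmissible (f : Cover → ℝ) : Prop where
  isFunctionOnM : IsFunctionOnM f
  dependsOnlyOnXY : DependsOnlyOnXY f
  lap_lt : ∀ p, 0 < 1 - pd 0 (pd 0 f) p - pd 1 (pd 1 f) p

/-- `h = - (1/2) (1 / (-1 + f_xx + f_yy)) Δ log(1 - f_xx - f_yy)`. -/
def hFun (f : Cover → ℝ) (p : Cover) : ℝ :=
  -(1 / 2) * (1 / (-1 + pd 0 (pd 0 f) p + pd 1 (pd 1 f) p)) *
    lap (fun q => Real.log (1 - pd 0 (pd 0 f) q - pd 1 (pd 1 f) q)) p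

/-- The function takes two different values. -/
def IsNonconstant (u : Cover → ℝ) : Prop := ∃ p q, u p ≠ u q

end KodairaThurston

end

noncomputable section

open scoped ContDiff

namespace KodairaThurston

/-! ## Evaluation and smoothness of forms -/

/-! Write θ = -e³ + df. Since Jθ = -e⁴ + d^c f, expanding θ ∧ Jθ produces all the mixed terms of the
type II deformation. The remaining terms e¹² - dd^c f equal φ e¹² with φ = 1 - f_xx - f_yy, so the
deformed form is φ e¹² + θ ∧ Jθ (`potForm`, with φ called `conf`; see `deformedForm_eq_potForm`).
The undeformed structure is the case f = 0, so every property is proved once, for general f.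

The metric is φ(dx² + dy²) + θ² + (Jθ)². It is positive exactly because φ > 0, and θ and Jθ are
orthogonal unit forms. From dθ = 0 and d(Jθ) = -φ e¹² one gets dω = θ ∧ ω (`extDeriv_potForm`). The
explicit Christoffel symbols (`christoffel_potForm`) show that θ is parallel. They also give a Ricci
tensor (`ricci_potForm`) whose trace is -Δ log φ / φ - 1/2 = -2h - 1/2. Hence the scalar curvature
is non-constant as soon as h is.

For the Chern-Ricci form, in any holomorphic chart the determinant of the metric is φ / (4|D|²),
with D the holomorphic Jacobian of the chart (`HolomorphicChart.det_hermMat`). Since log |D|² is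
pluriharmonic, only dd^c log φ = Δ log φ e¹² survives. A cosine in x provides an f with h
non-constant. -/

@[simp] lemma dcoord_apply (i : Fin 4) (v : Cover) : dcoord i v = v i := rfl

@[simp] lemma oneForm_apply (α : Cover → Cover →L[ℝ] ℝ) (p : Cover) (v : Fin 1 → Cover) :
    oneForm α p v = α p (v 0) := rfl

lemma const_eq_vec (v : Cover) : (fun _ : Fin 1 => v) = ![v] := by
  ext i; fin_cases i; rfl

lemma vec_one_eta (v : Fin 1 → Cover) : ![v 0] = v := by
  ext i; fin_cases i; rfl

lemma vec_two_eta (v : Fin 2 → Cover) : ![v 0, v 1] = v := by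
  ext i; fin_cases i <;> rfl

lemma vec_three_eta (v : Fin 3 → Cover) : ![v 0, v 1, v 2] = v := by
  ext i; fin_cases i <;> rfl

/-- Evaluation on explicit vectors, combined with `form_two_ext` and its analogues, turns identities
of forms into identities of real functions that `ring` can close. -/
lemma wedge_one_apply (α β : Form 1) (p u v : Cover) :
    wedge α β p ![u, v] = α p ![u] * β p ![v] - α p ![v] * β p ![u] := by
  have h0 : Fin.removeNth (0 : Fin 2) ![u, v] = ![v] := by ext i; fin_cases i; rfl
  have h1 : Fin.removeNth (1 : Fin 2) ![u, v] = ![u] := by ext i; fin_cases i; rfl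
  simp [wedge, ContinuousAlternatingMap.alternatizeUncurryFin_apply, Fin.sum_univ_two,
    const_eq_vec, h0, h1, sub_eq_add_neg]

lemma wedge_two_apply (α : Form 1) (β : Form 2) (p u v w : Cover) :
    wedge α β p ![u, v, w] = α p ![u] * β p ![v, w] - α p ![v] * β p ![u, w]
      + α p ![w] * β p ![u, v] := by
  have h0 : Fin.removeNth (0 : Fin 3) ![u, v, w] = ![v, w] := by
    ext i; fin_cases i <;> rfl
  have h1 : Fin.removeNth (1 : Fin 3) ![u, v, w] = ![u, w] := by
    ext i; fin_cases i <;> rfl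
  have h2 : Fin.removeNth (2 : Fin 3) ![u, v, w] = ![u, v] := by
    ext i; fin_cases i <;> rfl
  simp [wedge, ContinuousAlternatingMap.alternatizeUncurryFin_apply, Fin.sum_univ_three,
    const_eq_vec, h0, h1, h2, sub_eq_add_neg]

lemma form_one_ext {α β : Cover [⋀^Fin 1]→L[ℝ] ℝ} (h : ∀ u, α ![u] = β ![u]) : α = β := by
  ext v; rw [← vec_one_eta v]; exact h _

lemma form_two_ext {α β : Cover [⋀^Fin 2]→L[ℝ] ℝ} (h : ∀ u v, α ![u, v] = β ![u, v]) :
    α = β := by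
  ext v; rw [← vec_two_eta v]; exact h _ _

lemma form_three_ext {α β : Cover [⋀^Fin 3]→L[ℝ] ℝ} (h : ∀ u v w, α ![u, v, w] = β ![u, v, w]) :
    α = β := by
  ext v; rw [← vec_three_eta v]; exact h _ _ _

lemma contDiffAt_oneForm {n : WithTop ℕ∞} {α : Cover → Cover →L[ℝ] ℝ} {p : Cover}
    (h : ContDiffAt ℝ n α p) : ContDiffAt ℝ n (oneForm α) p := by
  -- The identification of functionals with 1-forms is linear, hence continuous because its domain
  -- is finite-dimensional.
  let L : (Cover →L[ℝ] ℝ) →ₗ[ℝ] (Cover [⋀^Fin 1]→L[ℝ] ℝ) :=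
    { toFun := ContinuousAlternatingMap.ofSubsingleton ℝ Cover ℝ (0 : Fin 1)
      map_add' := fun _ _ => rfl
      map_smul' := fun _ _ => rfl }
  exact L.toContinuousLinearMap.contDiff.contDiffAt.comp p h

lemma contDiff_oneForm {n : WithTop ℕ∞} {α : Cover → Cover →L[ℝ] ℝ}
    (h : ContDiff ℝ n α) : ContDiff ℝ n (oneForm α) :=
  contDiff_iff_contDiffAt.2 fun p => contDiffAt_oneForm h.contDiffAt

lemma contDiff_wedge_oneForm {n : WithTop ℕ∞} {k : ℕ} {α : Cover → Cover →L[ℝ] ℝ} {β : Form k}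
    (hα : ContDiff ℝ n α) (hβ : ContDiff ℝ n β) : ContDiff ℝ n (wedge (oneForm α) β) := by
  have h : wedge (oneForm α) β = fun p =>
      ContinuousAlternatingMap.alternatizeUncurryFinCLM ℝ Cover ℝ ((α p).smulRight (β p)) := by
    funext p
    simp only [wedge, oneForm, Equiv.symm_apply_apply,
      ContinuousAlternatingMap.alternatizeUncurryFinCLM_apply]
  rw [h]
  exact (ContinuousAlternatingMap.alternatizeUncurryFinCLM ℝ Cover ℝ).contDiff.comp
    (hα.smulRight hβ)

lemma extDeriv_one_apply {α : Form 1} {p : Cover} (h : DifferentiableAt ℝ α p) (u v : Cover) :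
    extDeriv α p ![u, v] = fderiv ℝ (fun q => α q ![v]) p u - fderiv ℝ (fun q => α q ![u]) p v := by
  have h0 : Fin.removeNth (0 : Fin 2) ![u, v] = ![v] := by ext i; fin_cases i; rfl
  have h1 : Fin.removeNth (1 : Fin 2) ![u, v] = ![u] := by ext i; fin_cases i; rfl
  rw [extDeriv_apply h]
  simp [Fin.sum_univ_two, h0, h1, sub_eq_add_neg]

lemma extDeriv_two_apply {α : Form 2} {p : Cover} (h : DifferentiableAt ℝ α p) (u v w : Cover) :
    extDeriv α p ![u, v, w] = fderiv ℝ (fun q => α q ![v, w]) p u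
      - fderiv ℝ (fun q => α q ![u, w]) p v + fderiv ℝ (fun q => α q ![u, v]) p w := by
  have h0 : Fin.removeNth (0 : Fin 3) ![u, v, w] = ![v, w] := by
    ext i; fin_cases i <;> rfl
  have h1 : Fin.removeNth (1 : Fin 3) ![u, v, w] = ![u, w] := by
    ext i; fin_cases i <;> rfl
  have h2 : Fin.removeNth (2 : Fin 3) ![u, v, w] = ![u, v] := by
    ext i; fin_cases i <;> rfl
  rw [extDeriv_apply h]
  simp [Fin.sum_univ_three, h0, h1, h2, sub_eq_add_neg]

/-! ## The complex structure in coordinates -/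

lemma J_eq (p v : Cover) :
    J p v = ![v 1, -v 0, v 3 - p 0 * v 0, p 0 * v 1 - v 2] := by
  ext i; fin_cases i <;> simp [J, frame] <;> ring

@[simp] lemma J_apply_zero (p v : Cover) : J p v 0 = v 1 := by simp [J_eq]
@[simp] lemma J_apply_one (p v : Cover) : J p v 1 = -v 0 := by simp [J_eq]
@[simp] lemma J_apply_two (p v : Cover) : J p v 2 = v 3 - p 0 * v 0 := by simp [J_eq]
@[simp] lemma J_apply_three (p v : Cover) : J p v 3 = p 0 * v 1 - v 2 := by simp [J_eq]

@[simp] lemma Jform_apply (α : Form 1) (p u : Cover) : Jform α p ![u] = -α p ![J p u] := by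
  simp only [Jform, ContinuousAlternatingMap.neg_apply,
    ContinuousAlternatingMap.compContinuousLinearMap_apply]
  congr 2
  ext i; fin_cases i; rfl

lemma Jform_oneForm (α : Cover → Cover →L[ℝ] ℝ) :
    Jform (oneForm α) = oneForm fun p => -(α p).comp (J p) := by
  funext p
  exact form_one_ext fun u => by simp

lemma contDiff_coord (i : Fin 4) : ContDiff ℝ ∞ fun p : Cover => p i := contDiff_apply ℝ ℝ i

lemma contDiff_J : ContDiff ℝ ∞ J := by
  refine contDiff_clm_apply_iff.2 fun v => ?_
  simp only [J_eq]
  refine contDiff_pi.2 fun i => ?_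
  have := contDiff_coord 0
  fin_cases i <;> (simp; fun_prop)

@[simp] lemma dfun_apply (u : Cover → ℝ) (p v : Cover) : dfun u p ![v] = fderiv ℝ u p v := rfl

@[simp] lemma e1_apply (p v : Cover) : e1 p ![v] = v 1 := rfl
@[simp] lemma e2_apply (p v : Cover) : e2 p ![v] = v 0 := rfl
@[simp] lemma e3_apply (p v : Cover) : e3 p ![v] = v 3 := rfl
@[simp] lemma e4_apply (p v : Cover) : e4 p ![v] = v 2 - p 0 * v 1 := rfl

/-! ## Smooth functions of `x, y` -/

/-- Smooth functions on the cover that depend only on `x, y`. -/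
structure IsSmoothXY (u : Cover → ℝ) : Prop where
  contDiff : ContDiff ℝ ∞ u
  dependsOnlyOnXY : DependsOnlyOnXY u

lemma cover_eq_sum (v : Cover) :
    v = v 0 • cvec 0 + v 1 • cvec 1 + v 2 • cvec 2 + v 3 • cvec 3 := by
  ext i; fin_cases i <;> simp [cvec]

namespace IsSmoothXY

variable {u u' : Cover → ℝ}

lemma differentiable (hu : IsSmoothXY u) : Differentiable ℝ u :=
  hu.contDiff.differentiable (by simp)

lemma const (c : ℝ) : IsSmoothXY fun _ => c := ⟨contDiff_const, fun _ _ _ _ => rfl⟩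

lemma coord_zero : IsSmoothXY fun p => p 0 := ⟨contDiff_coord 0, fun _ _ h _ => h⟩

lemma add (hu : IsSmoothXY u) (hu' : IsSmoothXY u') : IsSmoothXY fun p => u p + u' p :=
  ⟨hu.contDiff.add hu'.contDiff, fun p q h0 h1 => by
    simp only [hu.dependsOnlyOnXY p q h0 h1, hu'.dependsOnlyOnXY p q h0 h1]⟩

lemma sub (hu : IsSmoothXY u) (hu' : IsSmoothXY u') : IsSmoothXY fun p => u p - u' p :=
  ⟨hu.contDiff.sub hu'.contDiff, fun p q h0 h1 => by
    simp only [hu.dependsOnlyOnXY p q h0 h1, hu'.dependsOnlyOnXY p q h0 h1]⟩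

lemma mul (hu : IsSmoothXY u) (hu' : IsSmoothXY u') : IsSmoothXY fun p => u p * u' p :=
  ⟨hu.contDiff.mul hu'.contDiff, fun p q h0 h1 => by
    simp only [hu.dependsOnlyOnXY p q h0 h1, hu'.dependsOnlyOnXY p q h0 h1]⟩

lemma div (hu : IsSmoothXY u) (hu' : IsSmoothXY u') (h0 : ∀ p, u' p ≠ 0) :
    IsSmoothXY fun p => u p / u' p :=
  ⟨hu.contDiff.div hu'.contDiff h0, fun p q h0 h1 => by
    simp only [hu.dependsOnlyOnXY p q h0 h1, hu'.dependsOnlyOnXY p q h0 h1]⟩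

lemma log (hu : IsSmoothXY u) (h0 : ∀ p, u p ≠ 0) : IsSmoothXY fun p => Real.log (u p) :=
  ⟨hu.contDiff.log h0, fun p q h0 h1 => by simp only [hu.dependsOnlyOnXY p q h0 h1]⟩

/-- `u` is constant on the line through `p` in a fibre direction. -/
lemma fderiv_apply_eq_zero (hu : IsSmoothXY u) (p v : Cover) (h0 : v 0 = 0) (h1 : v 1 = 0) :
    fderiv ℝ u p v = 0 := by
  rw [← (hu.differentiable p).lineDeriv_eq_fderiv]
  have h : (fun t : ℝ => u (p + t • v)) = fun _ => u p := by
    funext t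
    exact hu.dependsOnlyOnXY _ _ (by simp [h0]) (by simp [h1])
  simp [lineDeriv, h]

lemma fderiv_apply (hu : IsSmoothXY u) (p v : Cover) :
    fderiv ℝ u p v = pd 0 u p * v 0 + pd 1 u p * v 1 := by
  conv_lhs => rw [cover_eq_sum v]
  simp only [map_add, map_smul, smul_eq_mul]
  rw [hu.fderiv_apply_eq_zero p (cvec 2) (by simp [cvec]) (by simp [cvec]),
    hu.fderiv_apply_eq_zero p (cvec 3) (by simp [cvec]) (by simp [cvec])]
  simp only [pd]; ring

lemma pd_two (hu : IsSmoothXY u) (p : Cover) : pd 2 u p = 0 :=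
  hu.fderiv_apply_eq_zero p (cvec 2) (by simp [cvec]) (by simp [cvec])

lemma pd_three (hu : IsSmoothXY u) (p : Cover) : pd 3 u p = 0 :=
  hu.fderiv_apply_eq_zero p (cvec 3) (by simp [cvec]) (by simp [cvec])

lemma contDiff_fderiv (hu : IsSmoothXY u) : ContDiff ℝ ∞ (fderiv ℝ u) :=
  hu.contDiff.fderiv_right (by simp)

lemma pd (hu : IsSmoothXY u) (i : Fin 4) : IsSmoothXY (pd i u) := by
  refine ⟨hu.contDiff_fderiv.clm_apply contDiff_const, fun p q h0 h1 => ?_⟩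
  -- Translation by `q - p` moves only `z, w`, so it fixes `u`. Differentiation commutes with
  -- translations.
  have h : (fun r => u (r + (q - p))) = u := by
    funext r
    exact hu.dependsOnlyOnXY _ _ (by simp [h0]) (by simp [h1])
  have h' := fderiv_comp_add_right (𝕜 := ℝ) (f := u) (x := p) (q - p)
  rw [h, add_sub_cancel] at h'
  simp only [KodairaThurston.pd, h']

lemma pd_comm (hu : IsSmoothXY u) (i j : Fin 4) (p : Cover) :
    KodairaThurston.pd i (KodairaThurston.pd j u) p =
      KodairaThurston.pd j (KodairaThurston.pd i u) p := by
  have hd : DifferentiableAt ℝ (fderiv ℝ u) p := hu.contDiff_fderiv.differentiable (by simp) p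
  have h (k l : Fin 4) : KodairaThurston.pd k (KodairaThurston.pd l u) p
      = fderiv ℝ (fderiv ℝ u) p (cvec k) (cvec l) := by
    change fderiv ℝ (fun q => fderiv ℝ u q (cvec l)) p (cvec k) = _
    rw [fderiv_clm_apply hd (differentiableAt_const _)]
    simp
  rw [h, h]
  exact (hu.contDiff.contDiffAt.isSymmSndFDerivAt (by simpa using WithTop.coe_le_coe.2 (le_top : (2 : ℕ∞) ≤ ⊤))) _ _

end IsSmoothXY

/-! ### Rules for partial derivatives -/

section pd

variable {u v : Cover → ℝ} {p : Cover}

lemma pd_add (i : Fin 4) (hu : DifferentiableAt ℝ u p) (hv : DifferentiableAt ℝ v p) :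
    pd i (fun q => u q + v q) p = pd i u p + pd i v p := by
  simp [pd, fderiv_fun_add hu hv]

lemma pd_sub (i : Fin 4) (hu : DifferentiableAt ℝ u p) (hv : DifferentiableAt ℝ v p) :
    pd i (fun q => u q - v q) p = pd i u p - pd i v p := by
  simp [pd, fderiv_fun_sub hu hv]

lemma pd_mul (i : Fin 4) (hu : DifferentiableAt ℝ u p) (hv : DifferentiableAt ℝ v p) :
    pd i (fun q => u q * v q) p = pd i u p * v p + u p * pd i v p := by
  simp [pd, fderiv_fun_mul hu hv]; ring

lemma pd_neg (i : Fin 4) : pd i (fun q => -u q) p = -pd i u p := by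
  simp [pd, fderiv_fun_neg]

lemma pd_div_const (i : Fin 4) (c : ℝ) (hu : DifferentiableAt ℝ u p) :
    pd i (fun q => u q / c) p = pd i u p / c := by
  simp [pd, div_eq_mul_inv, fderiv_mul_const hu]; ring

@[simp] lemma pd_const (i : Fin 4) (c : ℝ) : pd i (fun _ => c) p = 0 := by
  simp [pd]

@[simp] lemma pd_coord (i j : Fin 4) : pd i (fun q => q j) p = cvec i j := by
  have h : HasFDerivAt (fun q : Cover => q j) (dcoord j) p := (dcoord j).hasFDerivAt
  simp [pd, h.fderiv]

lemma pd_log (i : Fin 4) (hu : DifferentiableAt ℝ u p) (h0 : u p ≠ 0) :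
    pd i (fun q => Real.log (u q)) p = pd i u p / u p := by
  simp [pd, fderiv.log hu h0]; ring

end pd

variable {f : Cover → ℝ}

/-! ## The deformed structure -/

/-- The factor `1 - f_xx - f_yy`. -/
def conf (f : Cover → ℝ) (p : Cover) : ℝ := 1 - pd 0 (pd 0 f) p - pd 1 (pd 1 f) p

/-- The Lee form `-e³ + df`. -/
abbrev leeForm (f : Cover → ℝ) : Form 1 := deformedLee (-e3) f

/-- The form `(1 - f_xx - f_yy) e¹² + θ ∧ Jθ` for `θ = -e³ + df`. -/
def potForm (f : Cover → ℝ) : Form 2 := fun p =>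
  conf f p • wedge e1 e2 p + wedge (leeForm f) (Jform (leeForm f)) p

lemma IsSmoothXY.conf (hf : IsSmoothXY f) : IsSmoothXY (conf f) :=
  ((IsSmoothXY.const 1).sub ((hf.pd 0).pd 0)).sub ((hf.pd 1).pd 1)

lemma isSmoothXY_zero : IsSmoothXY 0 := IsSmoothXY.const 0

lemma conf_zero (p : Cover) : conf 0 p = 1 := by
  have h (i : Fin 4) : pd i (0 : Cover → ℝ) = 0 := by funext q; exact pd_const i 0
  simp [conf, h]

lemma leeForm_eq_oneForm (f : Cover → ℝ) :
    leeForm f = oneForm fun p => -dcoord 3 + fderiv ℝ f p := by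
  funext p
  exact form_one_ext fun u => rfl

lemma leeForm_apply (hf : IsSmoothXY f) (p v : Cover) :
    leeForm f p ![v] = pd 0 f p * v 0 + pd 1 f p * v 1 - v 3 := by
  rw [leeForm_eq_oneForm]
  simp [hf.fderiv_apply]; ring

lemma Jform_leeForm_apply (hf : IsSmoothXY f) (p v : Cover) :
    Jform (leeForm f) p ![v] = pd 1 f p * v 0 + (p 0 - pd 0 f p) * v 1 - v 2 := by
  rw [Jform_apply, leeForm_apply hf]
  simp; ring

lemma potForm_apply (hf : IsSmoothXY f) (p u v : Cover) :
    potForm f p ![u, v] = conf f p * (u 1 * v 0 - v 1 * u 0)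
      + (pd 0 f p * u 0 + pd 1 f p * u 1 - u 3)
        * (pd 1 f p * v 0 + (p 0 - pd 0 f p) * v 1 - v 2)
      - (pd 0 f p * v 0 + pd 1 f p * v 1 - v 3)
        * (pd 1 f p * u 0 + (p 0 - pd 0 f p) * u 1 - u 2) := by
  simp only [potForm, ContinuousAlternatingMap.add_apply, ContinuousAlternatingMap.smul_apply,
    wedge_one_apply, leeForm_apply hf, Jform_leeForm_apply hf, e1_apply, e2_apply, smul_eq_mul]
  ring

/-- Makes the undeformed structure a special case, so that it needs no computation of its own. -/
lemma omega0_eq_potForm : omega0 = potForm 0 := by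
  have h (i : Fin 4) (p : Cover) : pd i (0 : Cover → ℝ) p = 0 := pd_const i 0
  funext p
  refine form_two_ext fun u v => ?_
  rw [potForm_apply isSmoothXY_zero]
  simp only [omega0, Pi.add_apply, ContinuousAlternatingMap.add_apply, wedge_one_apply, e1_apply,
    e2_apply, e3_apply, e4_apply, conf_zero, h]
  ring

lemma neg_e3_eq_leeForm : -e3 = leeForm 0 := by
  have h (i : Fin 4) (p : Cover) : pd i (0 : Cover → ℝ) p = 0 := pd_const i 0
  funext p
  refine form_one_ext fun u => ?_
  rw [leeForm_apply isSmoothXY_zero]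
  simp [h]

/-! ## Smoothness and exterior derivatives -/

lemma contDiff_leeForm_coeff (hf : IsSmoothXY f) :
    ContDiff ℝ ∞ fun p => -dcoord 3 + fderiv ℝ f p :=
  contDiff_const.add hf.contDiff_fderiv

lemma contDiff_leeForm (hf : IsSmoothXY f) : ContDiff ℝ ∞ (leeForm f) := by
  rw [leeForm_eq_oneForm]
  exact contDiff_oneForm (contDiff_leeForm_coeff hf)

lemma contDiff_Jform_oneForm {α : Cover → Cover →L[ℝ] ℝ} (h : ContDiff ℝ ∞ α) :
    ContDiff ℝ ∞ (Jform (oneForm α)) := by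
  rw [Jform_oneForm]
  exact contDiff_oneForm (h.clm_comp contDiff_J).neg

lemma contDiff_Jform_leeForm (hf : IsSmoothXY f) : ContDiff ℝ ∞ (Jform (leeForm f)) := by
  rw [leeForm_eq_oneForm]
  exact contDiff_Jform_oneForm (contDiff_leeForm_coeff hf)

lemma contDiff_Jform_dfun (hf : IsSmoothXY f) : ContDiff ℝ ∞ (Jform (dfun f)) :=
  contDiff_Jform_oneForm hf.contDiff_fderiv

lemma contDiff_potForm (hf : IsSmoothXY f) : ContDiff ℝ ∞ (potForm f) := by
  refine (hf.conf.contDiff.smul ?_).add ?_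
  · exact contDiff_wedge_oneForm contDiff_const (contDiff_oneForm contDiff_const)
  · have := contDiff_wedge_oneForm (contDiff_leeForm_coeff hf) (contDiff_Jform_leeForm hf)
    rwa [← leeForm_eq_oneForm] at this

lemma isSmoothXY_leeForm_apply (hf : IsSmoothXY f) (v : Cover) :
    IsSmoothXY fun p => leeForm f p ![v] := by
  simp only [leeForm_apply hf]
  exact (((hf.pd 0).mul (.const _)).add ((hf.pd 1).mul (.const _))).sub (.const _)

lemma isSmoothXY_Jform_leeForm_apply (hf : IsSmoothXY f) (v : Cover) :
    IsSmoothXY fun p => Jform (leeForm f) p ![v] := by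
  simp only [Jform_leeForm_apply hf]
  exact (((hf.pd 1).mul (.const _)).add
    ((IsSmoothXY.coord_zero.sub (hf.pd 0)).mul (.const _))).sub (.const _)

lemma isSmoothXY_wedge_e1_e2_apply (u v : Cover) : IsSmoothXY fun p => wedge e1 e2 p ![u, v] := by
  simp only [wedge_one_apply, e1_apply, e2_apply]
  exact .const _

lemma isSmoothXY_potForm_apply (hf : IsSmoothXY f) (u v : Cover) :
    IsSmoothXY fun p => potForm f p ![u, v] := by
  simp only [potForm, ContinuousAlternatingMap.add_apply, ContinuousAlternatingMap.smul_apply,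
    smul_eq_mul, wedge_one_apply (leeForm f)]
  have hA := isSmoothXY_leeForm_apply hf
  have hB := isSmoothXY_Jform_leeForm_apply hf
  exact (hf.conf.mul (isSmoothXY_wedge_e1_e2_apply u v)).add
    (((hA u).mul (hB v)).sub ((hA v).mul (hB u)))

lemma pd_leeForm_apply (hf : IsSmoothXY f) (i : Fin 4) (p v : Cover) :
    pd i (fun q => leeForm f q ![v]) p = pd i (pd 0 f) p * v 0 + pd i (pd 1 f) p * v 1 := by
  have h0 := (hf.pd 0).differentiable
  have h1 := (hf.pd 1).differentiable
  simp only [leeForm_apply hf]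
  simp (disch := fun_prop) only [pd_add, pd_sub, pd_mul, pd_const]
  ring

lemma pd_Jform_leeForm_apply (hf : IsSmoothXY f) (i : Fin 4) (p v : Cover) :
    pd i (fun q => Jform (leeForm f) q ![v]) p =
      pd i (pd 1 f) p * v 0 + (cvec i 0 - pd i (pd 0 f) p) * v 1 := by
  have h0 := (hf.pd 0).differentiable
  have h1 := (hf.pd 1).differentiable
  simp only [Jform_leeForm_apply hf]
  simp (disch := fun_prop) only [pd_add, pd_sub, pd_mul, pd_const, pd_coord]
  ring

lemma pd_potForm_apply (hf : IsSmoothXY f) (i : Fin 4) (p u v : Cover) :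
    pd i (fun q => potForm f q ![u, v]) p = pd i (conf f) p * (u 1 * v 0 - v 1 * u 0)
      + ((pd i (pd 0 f) p * u 0 + pd i (pd 1 f) p * u 1)
          * (pd 1 f p * v 0 + (p 0 - pd 0 f p) * v 1 - v 2)
        + (pd 0 f p * u 0 + pd 1 f p * u 1 - u 3)
          * (pd i (pd 1 f) p * v 0 + (cvec i 0 - pd i (pd 0 f) p) * v 1))
      - ((pd i (pd 0 f) p * v 0 + pd i (pd 1 f) p * v 1)
          * (pd 1 f p * u 0 + (p 0 - pd 0 f p) * u 1 - u 2)
        + (pd 0 f p * v 0 + pd 1 f p * v 1 - v 3)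
          * (pd i (pd 1 f) p * u 0 + (cvec i 0 - pd i (pd 0 f) p) * u 1)) := by
  have h0 := (hf.pd 0).differentiable
  have h1 := (hf.pd 1).differentiable
  have hC := hf.conf.differentiable
  simp only [potForm_apply hf]
  simp (disch := fun_prop) only [pd_add, pd_sub, pd_mul, pd_const, pd_coord]
  ring

/-- The coefficients are those of df up to constants, so this is the symmetry of second derivatives.
-/
lemma extDeriv_leeForm (hf : IsSmoothXY f) (p : Cover) : extDeriv (leeForm f) p = 0 := by
  refine form_two_ext fun u v => ?_
  rw [extDeriv_one_apply ((contDiff_leeForm hf).differentiable (by simp) p),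
    (isSmoothXY_leeForm_apply hf v).fderiv_apply, (isSmoothXY_leeForm_apply hf u).fderiv_apply]
  simp only [pd_leeForm_apply hf, hf.pd_comm 1 0]
  change _ = (0 : ℝ)
  ring

/-- Here Jθ = -e⁴ + d^c f, with de⁴ = -dx ∧ dy = e¹² and dd^c f = Δf e¹². -/
lemma extDeriv_Jform_leeForm (hf : IsSmoothXY f) (p : Cover) :
    extDeriv (Jform (leeForm f)) p = (-conf f p) • wedge e1 e2 p := by
  refine form_two_ext fun u v => ?_
  rw [extDeriv_one_apply ((contDiff_Jform_leeForm hf).differentiable (by simp) p),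
    (isSmoothXY_Jform_leeForm_apply hf v).fderiv_apply,
    (isSmoothXY_Jform_leeForm_apply hf u).fderiv_apply]
  simp only [pd_Jform_leeForm_apply hf, hf.pd_comm 1 0, ContinuousAlternatingMap.smul_apply,
    wedge_one_apply, e1_apply, e2_apply, smul_eq_mul, conf, cvec]
  simp
  ring

/-- The form φ e¹² is closed because φ depends only on x, y. Then d(θ ∧ Jθ) = -θ ∧ d(Jθ) = φ θ ∧
e¹², which is θ ∧ ω since θ ∧ θ = 0. -/
lemma extDeriv_potForm (hf : IsSmoothXY f) (p : Cover) :
    extDeriv (potForm f) p = wedge (leeForm f) (potForm f) p := by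
  refine form_three_ext fun u v w => ?_
  rw [extDeriv_two_apply ((contDiff_potForm hf).differentiable (by simp) p),
    (isSmoothXY_potForm_apply hf v w).fderiv_apply,
    (isSmoothXY_potForm_apply hf u w).fderiv_apply,
    (isSmoothXY_potForm_apply hf u v).fderiv_apply, wedge_two_apply]
  simp only [pd_potForm_apply hf]
  simp only [potForm_apply hf, leeForm_apply hf, hf.pd_comm 1 0, cvec]
  simp [conf]
  ring

/-- J df = f_y dx - f_x dy, and e¹² = dy ∧ dx. -/
lemma ddc_eq_lap (hf : IsSmoothXY f) (p : Cover) : ddc f p = lap f p • wedge e1 e2 p := by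
  have h (q v : Cover) : Jform (dfun f) q ![v] = pd 1 f q * v 0 - pd 0 f q * v 1 := by
    simp [hf.fderiv_apply]; ring
  have hs (v : Cover) : IsSmoothXY fun q => pd 1 f q * v 0 - pd 0 f q * v 1 :=
    ((hf.pd 1).mul (.const _)).sub ((hf.pd 0).mul (.const _))
  have h0 := (hf.pd 0).differentiable
  have h1 := (hf.pd 1).differentiable
  refine form_two_ext fun u v => ?_
  rw [ddc, extDeriv_one_apply ((contDiff_Jform_dfun hf).differentiable (by simp) p)]
  simp only [h, (hs _).fderiv_apply]
  simp (disch := fun_prop) only [pd_sub, pd_mul, pd_const, hf.pd_comm 1 0]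
  simp only [ContinuousAlternatingMap.smul_apply, wedge_one_apply, e1_apply, e2_apply,
    smul_eq_mul, lap]
  ring

/-! ## Invariance -/

lemma hasFDerivAt_deck (j k m n : ℤ) (p : Cover) :
    HasFDerivAt (deck j k m n)
      (ContinuousLinearMap.id ℝ Cover + (dcoord 1).smulRight ((j : ℝ) • cvec 2)) p := by
  rw [hasFDerivAt_pi']
  have h (i : Fin 4) : HasFDerivAt (fun p : Cover => p i) (dcoord i) p := (dcoord i).hasFDerivAt
  intro i
  fin_cases i
  · refine ((h 0).add_const (j : ℝ)).congr_fderiv ?_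
    ext v; simp [cvec]
  · refine ((h 1).add_const (k : ℝ)).congr_fderiv ?_
    ext v; simp [cvec]
  · refine (((h 2).add ((h 1).const_mul (j : ℝ))).add_const (m : ℝ)).congr_fderiv ?_
    ext v; simp [cvec, mul_comm]
  · refine ((h 3).add_const (n : ℝ)).congr_fderiv ?_
    ext v; simp [cvec]

lemma fderiv_deck (j k m n : ℤ) (p v : Cover) :
    fderiv ℝ (deck j k m n) p v = ![v 0, v 1, v 2 + j * v 1, v 3] := by
  rw [(hasFDerivAt_deck j k m n p).fderiv]
  ext i; fin_cases i <;> simp [cvec, mul_comm]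

lemma isFormOnM_one {α : Form 1} (h : ContDiff ℝ ∞ α)
    (h' : ∀ (j k m n : ℤ) (p u : Cover),
      α (deck j k m n p) ![![u 0, u 1, u 2 + j * u 1, u 3]] = α p ![u]) : IsFormOnM α := by
  refine ⟨h, fun j k m n p => form_one_ext fun u => ?_⟩
  rw [← h' j k m n p u, ContinuousAlternatingMap.compContinuousLinearMap_apply]
  congr 1
  ext i : 1; fin_cases i; exact fderiv_deck j k m n p u

lemma isFormOnM_two {α : Form 2} (h : ContDiff ℝ ∞ α)
    (h' : ∀ (j k m n : ℤ) (p u v : Cover), α (deck j k m n p)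
      ![![u 0, u 1, u 2 + j * u 1, u 3], ![v 0, v 1, v 2 + j * v 1, v 3]] = α p ![u, v]) :
    IsFormOnM α := by
  refine ⟨h, fun j k m n p => form_two_ext fun u v => ?_⟩
  rw [← h' j k m n p u v, ContinuousAlternatingMap.compContinuousLinearMap_apply]
  congr 1
  ext i : 1
  fin_cases i
  · exact fderiv_deck j k m n p u
  · exact fderiv_deck j k m n p v

/-- The differential of a deck transformation differs from the identity only in its z-component,
which `u` does not see. -/
lemma pd_deck {u : Cover → ℝ} (hu : IsSmoothXY u)
    (h : ∀ (j k m n : ℤ) (p : Cover), u (deck j k m n p) = u p) (i : Fin 4) (j k m n : ℤ)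
    (p : Cover) : pd i u (deck j k m n p) = pd i u p := by
  have hc : (u ∘ deck j k m n) = u := funext (h j k m n)
  have h2 : pd i u p = fderiv ℝ u (deck j k m n p) (fderiv ℝ (deck j k m n) p (cvec i)) := by
    conv_lhs => rw [pd, ← hc]
    rw [fderiv_comp p (hu.differentiable _) (hasFDerivAt_deck j k m n p).differentiableAt]
    rfl
  rw [h2, pd, hu.fderiv_apply, hu.fderiv_apply, fderiv_deck]
  simp

lemma isSmoothXY_of_isAdmissible (hf : IsAdmissible f) : IsSmoothXY f :=
  ⟨hf.isFunctionOnM.1, hf.dependsOnlyOnXY⟩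

lemma isFormOnM_leeForm (hf : IsSmoothXY f)
    (h : ∀ (j k m n : ℤ) (p : Cover), f (deck j k m n p) = f p) : IsFormOnM (leeForm f) :=
  isFormOnM_one (contDiff_leeForm hf) fun j k m n p u => by
    simp [leeForm_apply hf, pd_deck hf h]

lemma isFormOnM_potForm (hf : IsSmoothXY f)
    (h : ∀ (j k m n : ℤ) (p : Cover), f (deck j k m n p) = f p) : IsFormOnM (potForm f) :=
  isFormOnM_two (contDiff_potForm hf) fun j k m n p u v => by
    have h' (i : Fin 4) := pd_deck (hf.pd i) (pd_deck hf h i) i j k m n p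
    simp only [potForm_apply hf, pd_deck hf h, conf, h']
    simp [deck]
    ring

lemma isT2Invariant_potForm (hf : IsSmoothXY f) : IsT2Invariant (potForm f) := by
  intro i p q h0 h1
  have h : ∀ p : Cover, (fun a => frame (i a) p) = ![frame (i 0) p, frame (i 1) p] := fun p =>
    (vec_two_eta fun a => frame (i a) p).symm
  -- The frame depends on the point only through x.
  have hF (a : Fin 4) : frame a p = frame a q := by simp [frame, h0]
  simp only [h, hF]
  exact (isSmoothXY_potForm_apply hf _ _).dependsOnlyOnXY p q h0 h1

/-! ## The metric -/

lemma metric_potForm (hf : IsSmoothXY f) (p u v : Cover) :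
    metric (potForm f) p u v = conf f p * (u 0 * v 0 + u 1 * v 1)
      + (pd 0 f p * u 0 + pd 1 f p * u 1 - u 3) * (pd 0 f p * v 0 + pd 1 f p * v 1 - v 3)
      + (pd 1 f p * u 0 + (p 0 - pd 0 f p) * u 1 - u 2)
        * (pd 1 f p * v 0 + (p 0 - pd 0 f p) * v 1 - v 2) := by
  simp [metric, potForm_apply hf]
  ring

lemma isFundamentalForm_potForm (hf : IsSmoothXY f)
    (h : ∀ (j k m n : ℤ) (p : Cover), f (deck j k m n p) = f p) (hpos : ∀ p, 0 < conf f p) :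
    IsFundamentalForm (potForm f) where
  isFormOnM := isFormOnM_potForm hf h
  J_invariant p X Y := by
    simp only [potForm_apply hf, J_apply_zero, J_apply_one, J_apply_two, J_apply_three]
    ring
  positive p X hX := by
    rw [metric_potForm hf]
    -- The three summands of the metric are nonnegative, so all of them vanish. The first forces `X
    -- 0 = X 1 = 0`; then θ and Jθ reduce to `-X 3` and `-X 2`.
    by_contra! hle
    have hp := hpos p
    have h1 := mul_nonneg hp.le (add_nonneg (mul_self_nonneg (X 0)) (mul_self_nonneg (X 1)))
    have h2 := mul_self_nonneg (pd 0 f p * X 0 + pd 1 f p * X 1 - X 3)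
    have h3 := mul_self_nonneg (pd 1 f p * X 0 + (p 0 - pd 0 f p) * X 1 - X 2)
    have h4 : X 0 * X 0 + X 1 * X 1 = 0 :=
      (mul_eq_zero.1 (le_antisymm (by linarith) h1)).resolve_left hp.ne'
    have hx0 : X 0 = 0 := by
      nlinarith [mul_self_nonneg (X 0), mul_self_nonneg (X 1)]
    have hx1 : X 1 = 0 := by
      nlinarith [mul_self_nonneg (X 0), mul_self_nonneg (X 1)]
    rw [hx0, hx1] at h2 h3 hle
    have hx3 : X 3 = 0 := by
      nlinarith [mul_self_nonneg (X 2), mul_self_nonneg (X 3)]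
    have hx2 : X 2 = 0 := by
      nlinarith [mul_self_nonneg (X 2), mul_self_nonneg (X 3)]
    apply hX
    ext i; fin_cases i <;> simp [hx0, hx1, hx2, hx3]

/-! ## The Levi-Civita connection -/

lemma gMat_potForm (hf : IsSmoothXY f) (p : Cover) (i j : Fin 4) :
    gMat (potForm f) p i j = conf f p * (cvec i 0 * cvec j 0 + cvec i 1 * cvec j 1)
      + (pd 0 f p * cvec i 0 + pd 1 f p * cvec i 1 - cvec i 3)
        * (pd 0 f p * cvec j 0 + pd 1 f p * cvec j 1 - cvec j 3)
      + (pd 1 f p * cvec i 0 + (p 0 - pd 0 f p) * cvec i 1 - cvec i 2)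
        * (pd 1 f p * cvec j 0 + (p 0 - pd 0 f p) * cvec j 1 - cvec j 2) := by
  rw [gMat, Matrix.of_apply, metric_potForm hf]

/-- The inverse of the metric of `potForm f`. -/
def invMat (f : Cover → ℝ) (p : Cover) : Matrix (Fin 4) (Fin 4) ℝ :=
  let a := pd 0 f p
  let b := pd 1 f p
  let c := p 0 - pd 0 f p
  let s := (conf f p)⁻¹
  -- This is s (A ⊗ A + B ⊗ B) + ∂_z ⊗ ∂_z + ∂_w ⊗ ∂_w, where A = ∂_x + b ∂_z + a ∂_w and B = ∂_y +
  -- c ∂_z + b ∂_w are the lifts of ∂_x, ∂_y annihilated by θ and Jθ.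
  !![s, 0, s * b, s * a;
    0, s, s * c, s * b;
    s * b, s * c, s * (b * b + c * c) + 1, s * (a * b + b * c);
    s * a, s * b, s * (a * b + b * c), s * (a * a + b * b) + 1]

lemma gInv_potForm (hf : IsSmoothXY f) (hpos : ∀ p, 0 < conf f p) (p : Cover) :
    gInv (potForm f) p = invMat f p := by
  have h0 := (hpos p).ne'
  refine Matrix.inv_eq_right_inv ?_
  ext i j
  rw [Matrix.mul_apply, Fin.sum_univ_four]
  simp only [gMat_potForm hf]
  fin_cases i <;> fin_cases j <;> simp [invMat, cvec] <;> field_simp <;> ring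

lemma pd_gMat_potForm (hf : IsSmoothXY f) (l : Fin 4) (p : Cover) (i j : Fin 4) :
    pd l (fun q => gMat (potForm f) q i j) p =
      pd l (conf f) p * (cvec i 0 * cvec j 0 + cvec i 1 * cvec j 1)
      + ((pd l (pd 0 f) p * cvec i 0 + pd l (pd 1 f) p * cvec i 1)
          * (pd 0 f p * cvec j 0 + pd 1 f p * cvec j 1 - cvec j 3)
        + (pd 0 f p * cvec i 0 + pd 1 f p * cvec i 1 - cvec i 3)
          * (pd l (pd 0 f) p * cvec j 0 + pd l (pd 1 f) p * cvec j 1))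
      + ((pd l (pd 1 f) p * cvec i 0 + (cvec l 0 - pd l (pd 0 f) p) * cvec i 1)
          * (pd 1 f p * cvec j 0 + (p 0 - pd 0 f p) * cvec j 1 - cvec j 2)
        + (pd 1 f p * cvec i 0 + (p 0 - pd 0 f p) * cvec i 1 - cvec i 2)
          * (pd l (pd 1 f) p * cvec j 0 + (cvec l 0 - pd l (pd 0 f) p) * cvec j 1)) := by
  have h0 := (hf.pd 0).differentiable
  have h1 := (hf.pd 1).differentiable
  have hC := hf.conf.differentiable
  simp only [gMat_potForm hf]
  simp (disch := fun_prop) only [pd_add, pd_sub, pd_mul, pd_const, pd_coord]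
  ring

/-- Half the logarithmic derivative of the factor `1 - f_xx - f_yy`. -/
def halfLog (f : Cover → ℝ) (i : Fin 4) (p : Cover) : ℝ := pd i (conf f) p / (2 * conf f p)

/-- The Christoffel symbols of `potForm f`, as matrices indexed by the upper index. -/
def chrTable (f : Cover → ℝ) (p : Cover) : Fin 4 → Matrix (Fin 4) (Fin 4) ℝ :=
  let a := pd 0 f p
  let b := pd 1 f p
  let c := p 0 - pd 0 f p
  let P := halfLog f 0 p
  let Q := halfLog f 1 p
  -- With η = Jθ = (b, c, -1, 0): the terms in P, Q are the Christoffel symbols of φ(dx² + dy²). The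
  -- others are -(η ⊗ dy + dy ⊗ η)/2 in `G0` and (η ⊗ dx + dx ⊗ η)/2 in `G1`, coming from dη = -φ
  -- e¹².
  let G0 := !![P, Q - b / 2, 0, 0; Q - b / 2, -P - c, 1 / 2, 0; 0, 1 / 2, 0, 0; 0, 0, 0, 0]
  let G1 := !![b - Q, P + c / 2, -1 / 2, 0; P + c / 2, Q, 0, 0; -1 / 2, 0, 0, 0; 0, 0, 0, 0]
  let axx := pd 0 (pd 0 f) p
  let axy := pd 0 (pd 1 f) p
  let ayy := pd 1 (pd 1 f) p
  let S := !![axy, (1 - axx + ayy) / 2, 0, 0; (1 - axx + ayy) / 2, -axy, 0, 0;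
    0, 0, 0, 0; 0, 0, 0, 0]
  let H := !![axx, axy, 0, 0; axy, ayy, 0, 0; 0, 0, 0, 0; 0, 0, 0, 0]
  -- The last entry solves θ_k Γ^k = Hess f = ∂θ, that is ∇θ = 0. The third solves η_k Γ^k = `S`,
  -- the symmetrized ∂η, which says that the dual of η = Jθ is Killing.
  ![G0, G1, b • G0 + c • G1 - S, a • G0 + b • G1 - H]

set_option maxHeartbeats 1000000 in
lemma christoffel_potForm (hf : IsSmoothXY f) (hpos : ∀ p, 0 < conf f p) (k i j : Fin 4)
    (p : Cover) : christoffel (potForm f) k i j p = chrTable f p k i j := by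
  have h0 := (hpos p).ne'
  -- Eliminating f_xx leaves φ and the remaining derivatives as independent atoms for `field_simp`
  -- and `ring`.
  have hc : pd 0 (pd 0 f) p = 1 - conf f p - pd 1 (pd 1 f) p := by simp only [conf]; ring
  have hs := hf.pd_comm 1 0 p
  rw [christoffel, Fin.sum_univ_four]
  simp only [gInv_potForm hf hpos, pd_gMat_potForm hf]
  fin_cases k <;> fin_cases i <;> fin_cases j <;>
    simp [invMat, chrTable, halfLog, cvec, (hf.pd _).pd_two,
      (hf.pd _).pd_three, hf.conf.pd_two, hf.conf.pd_three, hs, hc] <;>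
    field_simp <;> ring

lemma isParallel_leeForm (hf : IsSmoothXY f) (hpos : ∀ p, 0 < conf f p) :
    IsParallel (potForm f) (leeForm f) := by
  intro i j p
  have hs := hf.pd_comm 1 0 p
  have h : pd i (comp (leeForm f) j) p = _ := pd_leeForm_apply hf i p (cvec j)
  rw [h]
  simp only [comp, leeForm_apply hf, christoffel_potForm hf hpos, Fin.sum_univ_four]
  fin_cases i <;> fin_cases j <;>
    simp [chrTable, cvec, (hf.pd _).pd_two, (hf.pd _).pd_three, hs] <;> ring

lemma normSq_leeForm (hf : IsSmoothXY f) (hpos : ∀ p, 0 < conf f p) (p : Cover) :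
    normSq (potForm f) (leeForm f) p = 1 := by
  simp only [normSq, gInv_potForm hf hpos, comp, leeForm_apply hf, Fin.sum_univ_four]
  simp [invMat, cvec]
  ring

lemma sharp_leeForm (hf : IsSmoothXY f) (hpos : ∀ p, 0 < conf f p) (p : Cover) :
    sharp (potForm f) (leeForm f) p = -cvec 3 := by
  ext i
  simp only [sharp, gInv_potForm hf hpos, comp, leeForm_apply hf, Fin.sum_univ_four]
  fin_cases i <;> simp [invMat, cvec] <;> ring

lemma isNormalizedVaisman_potForm (hf : IsSmoothXY f)
    (h : ∀ (j k m n : ℤ) (p : Cover), f (deck j k m n p) = f p) (hpos : ∀ p, 0 < conf f p) :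
    IsNormalizedVaisman (potForm f) (leeForm f) :=
  ⟨⟨isFundamentalForm_potForm hf h hpos, isFormOnM_leeForm hf h, extDeriv_leeForm hf,
    extDeriv_potForm hf, isParallel_leeForm hf hpos⟩, normSq_leeForm hf hpos⟩

/-! ## Curvature -/

lemma isSmoothXY_halfLog (hf : IsSmoothXY f) (hpos : ∀ p, 0 < conf f p) (i : Fin 4) :
    IsSmoothXY (halfLog f i) :=
  (hf.conf.pd i).div ((IsSmoothXY.const 2).mul hf.conf) fun p =>
    mul_ne_zero two_ne_zero (hpos p).ne'

lemma lap_log_conf (hf : IsSmoothXY f) (hpos : ∀ p, 0 < conf f p) (p : Cover) :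
    lap (fun q => Real.log (conf f q)) p =
      2 * (pd 0 (halfLog f 0) p + pd 1 (halfLog f 1) p) := by
  have h (i : Fin 4) : pd i (fun q => Real.log (conf f q)) = fun q => 2 * halfLog f i q := by
    funext q
    rw [pd_log i (hf.conf.differentiable q) (hpos q).ne', halfLog]
    have := (hpos q).ne'
    field_simp
  have hd (i : Fin 4) := (isSmoothXY_halfLog hf hpos i).differentiable
  have h0 := hd 0
  have h1 := hd 1
  rw [lap, h, h]
  simp (disch := fun_prop) only [pd_mul, pd_const]
  ring

/-- Both functions are partial derivatives of (log φ)/2. The off-diagonal Ricci terms need this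
symmetry. -/
lemma pd_halfLog_comm (hf : IsSmoothXY f) (hpos : ∀ p, 0 < conf f p) (p : Cover) :
    pd 1 (halfLog f 0) p = pd 0 (halfLog f 1) p := by
  have hl := hf.conf.log fun q => (hpos q).ne'
  have h (i : Fin 4) : halfLog f i = fun q => 1 / 2 * pd i (fun r => Real.log (conf f r)) q := by
    funext q
    rw [pd_log i (hf.conf.differentiable q) (hpos q).ne', halfLog]
    have := (hpos q).ne'
    field_simp
  have hd (i : Fin 4) := (hl.pd i).differentiable
  rw [h, h, pd_mul 1 (by fun_prop) (hd 0 p), pd_mul 0 (by fun_prop) (hd 1 p), hl.pd_comm 1 0]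
  simp

set_option maxHeartbeats 2000000 in
-- Geometrically, θ splits off a flat line, and Jθ is dual to a unit Killing field over the surface
-- with metric φ(dx² + dy²). That surface has Ricci tensor -(Δ log φ)/2 (dx² + dy²). Since d(Jθ) is
-- minus the area form e¹² scaled by φ, its constant unit length contributes -1/2 horizontally and
-- +1/2 along the fibre.
lemma ricci_potForm (hf : IsSmoothXY f) (hpos : ∀ p, 0 < conf f p) (j k : Fin 4) (p : Cover) :
    ricci (potForm f) j k p =
      -(pd 0 (halfLog f 0) p + pd 1 (halfLog f 1) p + conf f p / 2)
          * (cvec j 0 * cvec k 0 + cvec j 1 * cvec k 1)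
        + 1 / 2 * (pd 1 f p * cvec j 0 + (p 0 - pd 0 f p) * cvec j 1 - cvec j 2)
          * (pd 1 f p * cvec k 0 + (p 0 - pd 0 f p) * cvec k 1 - cvec k 2) := by
  have hG (k i j : Fin 4) : christoffel (potForm f) k i j = fun q => chrTable f q k i j :=
    funext fun q => christoffel_potForm hf hpos k i j q
  have ha := (hf.pd 0).differentiable
  have hb := (hf.pd 1).differentiable
  have hxx := ((hf.pd 0).pd 0).differentiable
  have hxy := ((hf.pd 1).pd 0).differentiable
  have hyy := ((hf.pd 1).pd 1).differentiable
  have hP := (isSmoothXY_halfLog hf hpos 0).differentiable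
  have hQ := (isSmoothXY_halfLog hf hpos 1).differentiable
  have hPQ := pd_halfLog_comm hf hpos p
  have hc : pd 0 (pd 0 f) p = 1 - conf f p - pd 1 (pd 1 f) p := by simp only [conf]; ring
  have hs := hf.pd_comm 1 0 p
  simp only [ricci, hG, Fin.sum_univ_four]
  fin_cases j <;> fin_cases k <;>
    simp [chrTable, cvec] <;>
    (try simp (disch := fun_prop) [pd_add, pd_sub, pd_mul, pd_neg, pd_div_const, (hf.pd _).pd_two,
      (hf.pd _).pd_three, ((hf.pd _).pd _).pd_two, ((hf.pd _).pd _).pd_three,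
      (isSmoothXY_halfLog hf hpos _).pd_two, (isSmoothXY_halfLog hf hpos _).pd_three, cvec,
      Pi.single_apply]) <;>
    (try simp only [hs, hPQ, hc]) <;> ring

lemma scalarCurvature_potForm (hf : IsSmoothXY f) (hpos : ∀ p, 0 < conf f p) (p : Cover) :
    scalarCurvature (potForm f) p = -lap (fun q => Real.log (conf f q)) p / conf f p - 1 / 2 := by
  have h0 := (hpos p).ne'
  rw [lap_log_conf hf hpos]
  simp only [scalarCurvature, gInv_potForm hf hpos, ricci_potForm hf hpos, Fin.sum_univ_four]
  simp [invMat, cvec]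
  field_simp
  ring

/-! ## Pluriharmonicity and the Chern-Ricci form -/

lemma two_le_infty : (2 : WithTop ℕ∞) ≤ ∞ := WithTop.coe_le_coe.2 le_top

lemma ddc_congr {u v : Cover → ℝ} {p : Cover} (h : u =ᶠ[nhds p] v) : ddc u p = ddc v p := by
  refine Filter.EventuallyEq.extDeriv_eq ?_
  filter_upwards [h.eventuallyEq_nhds] with q hq
  simp only [Jform, dfun, oneForm, hq.fderiv_eq]

lemma differentiableAt_Jform_dfun {u : Cover → ℝ} {p : Cover} (hu : ContDiffAt ℝ 2 u p) :
    DifferentiableAt ℝ (Jform (dfun u)) p := by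
  have h : Jform (dfun u) = oneForm fun q => -(fderiv ℝ u q).comp (J q) := Jform_oneForm _
  rw [h]
  refine (contDiffAt_oneForm (n := 1) ?_).differentiableAt one_ne_zero
  exact ((hu.fderiv_right (m := 1) (by norm_num)).clm_comp
    ((contDiff_J.of_le (by simp)).contDiffAt)).neg

lemma ddc_sub {u v : Cover → ℝ} {p : Cover} (hu : ContDiffAt ℝ 2 u p) (hv : ContDiffAt ℝ 2 v p) :
    ddc (fun q => u q - v q) p = ddc u p - ddc v p := by
  have h : Jform (dfun fun q => u q - v q) =ᶠ[nhds p]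
      Jform (dfun u) + (-1 : ℝ) • Jform (dfun v) := by
    filter_upwards [hu.eventually (by simp), hv.eventually (by simp)] with q hq hq'
    refine form_one_ext fun w => ?_
    simp only [Jform_apply, dfun_apply, Pi.add_apply, Pi.smul_apply,
      ContinuousAlternatingMap.add_apply, ContinuousAlternatingMap.smul_apply, smul_eq_mul]
    rw [fderiv_fun_sub (hq.differentiableAt two_ne_zero) (hq'.differentiableAt two_ne_zero)]
    simp; ring
  rw [ddc, h.extDeriv_eq, extDeriv_add (differentiableAt_Jform_dfun hu)
    ((differentiableAt_Jform_dfun hv).const_smul _), extDeriv_smul, neg_one_smul, ← sub_eq_add_neg]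
  rfl

lemma extDeriv_dfun {u : Cover → ℝ} {p : Cover} (hu : ContDiffAt ℝ 2 u p) :
    extDeriv (dfun u) p = 0 := by
  have h : dfun u = extDeriv fun q =>
      ContinuousAlternatingMap.constOfIsEmpty ℝ Cover (Fin 0) (u q) := by
    funext q
    rw [extDeriv_constOfIsEmpty]
    rfl
  rw [h]
  refine extDeriv_extDeriv_apply (r := 2) ?_ (by simp)
  exact (ContinuousAlternatingMap.constOfIsEmptyLIE ℝ Cover ℝ
    (Fin 0)).toContinuousLinearEquiv.contDiff.contDiffAt.comp p hu

/-- The real part of a holomorphic function is pluriharmonic. -/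
lemma ddc_re_eq_zero {K : Cover → ℂ} {p : Cover} (hK : ContDiffAt ℝ 2 K p)
    (hol : ∀ᶠ q in nhds p, ∀ v, fderiv ℝ K q (J q v) = Complex.I * fderiv ℝ K q v) :
    ddc (fun q => (K q).re) p = 0 := by
  have him : ContDiffAt ℝ 2 (fun q => (K q).im) p :=
    Complex.imCLM.contDiff.contDiffAt.comp p hK
  -- The Cauchy-Riemann equations say J d(Re K) = d(Im K), which is closed.
  rw [← extDeriv_dfun him]
  refine Filter.EventuallyEq.extDeriv_eq ?_
  filter_upwards [hol, hK.eventually (by simp)] with q hq hd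
  have hd' := (hd.differentiableAt two_ne_zero).hasFDerivAt
  have hre : fderiv ℝ (fun q => (K q).re) q = Complex.reCLM.comp (fderiv ℝ K q) :=
    (Complex.reCLM.hasFDerivAt.comp q hd').fderiv
  have him : fderiv ℝ (fun q => (K q).im) q = Complex.imCLM.comp (fderiv ℝ K q) :=
    (Complex.imCLM.hasFDerivAt.comp q hd').fderiv
  exact form_one_ext fun w => by simp [hre, him, hq]

/-- The logarithm of the modulus of a nonvanishing holomorphic function is pluriharmonic. -/
lemma ddc_log_normSq_eq_zero {D : Cover → ℂ} {p : Cover} (hD : ContDiffAt ℝ 2 D p)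
    (hol : ∀ᶠ q in nhds p, ∀ v, fderiv ℝ D q (J q v) = Complex.I * fderiv ℝ D q v)
    (h0 : D p ≠ 0) : ddc (fun q => Real.log (Complex.normSq (D q))) p = 0 := by
  -- Dividing by `D p` moves the value at `p` to 1, so the principal branch of the logarithm is
  -- holomorphic near it.
  let K : Cover → ℂ := fun q => 2 * Complex.log (D q / D p) + Real.log (Complex.normSq (D p))
  have hslit : D p / D p ∈ Complex.slitPlane := by simp [h0]
  have hcont : ContinuousAt (fun q => D q / D p) p := hD.continuousAt.div_const _
  have hev : ∀ᶠ q in nhds p, D q / D p ∈ Complex.slitPlane :=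
    hcont.eventually_mem (Complex.isOpen_slitPlane.mem_nhds hslit)
  have hlog (z : ℂ) (hz : z ∈ Complex.slitPlane) : ContDiffAt ℝ 2 Complex.log z :=
    (Complex.contDiffAt_log hz).restrict_scalars ℝ
  have hK : ContDiffAt ℝ 2 K p :=
    (contDiffAt_const.mul ((hlog _ hslit).comp p (hD.div_const _))).add contDiffAt_const
  have hre : (fun q => Real.log (Complex.normSq (D q))) =ᶠ[nhds p] fun q => (K q).re := by
    filter_upwards [hev] with q hq
    have hq0 : D q ≠ 0 := fun h => by simp [h] at hq
    simp only [K, Complex.add_re, Complex.mul_re, Complex.re_ofNat, Complex.im_ofNat, zero_mul,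
      sub_zero, Complex.log_re, Complex.ofReal_re, norm_div]
    rw [Real.log_div (norm_ne_zero_iff.2 hq0) (norm_ne_zero_iff.2 h0), Complex.normSq_eq_norm_sq,
      Complex.normSq_eq_norm_sq, Real.log_pow, Real.log_pow]
    push_cast; ring
  rw [ddc_congr hre]
  refine ddc_re_eq_zero hK ?_
  filter_upwards [hol, hev, hD.eventually (by simp)] with q hq hs hd v
  have hd' := (hd.differentiableAt two_ne_zero).hasFDerivAt
  have h1 : HasFDerivAt (fun q => D q / D p) ((D p)⁻¹ • fderiv ℝ D q) q := by
    simpa [div_eq_inv_mul] using hd'.const_mul (D p)⁻¹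
  have h2 := (((Complex.hasStrictDerivAt_log hs).hasDerivAt.comp_hasFDerivAt q h1).const_mul
    (2 : ℂ)).add_const ((Real.log (Complex.normSq (D p)) : ℝ) : ℂ)
  have h3 : fderiv ℝ K q = _ := h2.fderiv
  rw [h3]
  simp [hq]
  ring

/-- The derivative of a holomorphic function in the direction of a vector field `∂_y` or `∂_w`
preserving `J` is holomorphic. -/
lemma holomorphic_fderiv_const {ζ : Cover → ℂ} {p : Cover} (hζ : ContDiffAt ℝ 2 ζ p)
    (hol : ∀ᶠ q in nhds p, ∀ v, fderiv ℝ ζ q (J q v) = Complex.I * fderiv ℝ ζ q v)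
    {w : Cover} (hw : w 0 = 0) (v : Cover) :
    fderiv ℝ (fun q => fderiv ℝ ζ q w) p (J p v) =
      Complex.I * fderiv ℝ (fun q => fderiv ℝ ζ q w) p v := by
  have hd : DifferentiableAt ℝ (fderiv ℝ ζ) p :=
    (hζ.fderiv_right (m := 1) (by norm_num)).differentiableAt one_ne_zero
  have hsymm : IsSymmSndFDerivAt ℝ ζ p := hζ.isSymmSndFDerivAt (by simp)
  have hJ : HasFDerivAt (fun q => J q v)
      ((dcoord 0).smulRight (![0, 0, -v 0, v 1] : Cover)) p := by
    rw [hasFDerivAt_pi']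
    have h0 : HasFDerivAt (fun p : Cover => p 0) (dcoord 0) p := (dcoord 0).hasFDerivAt
    intro i
    simp only [J_eq]
    fin_cases i
    · refine (hasFDerivAt_const (v 1) p).congr_fderiv ?_
      ext; simp
    · refine (hasFDerivAt_const (-v 0) p).congr_fderiv ?_
      ext; simp
    · refine ((h0.mul_const (v 0)).const_sub (v 3)).congr_fderiv ?_
      ext; simp [mul_comm]
    · refine ((h0.mul_const (v 1)).sub_const (v 2)).congr_fderiv ?_
      ext; simp [mul_comm]
  have hconst (u q : Cover) : HasFDerivAt (fun _ : Cover => u) (0 : Cover →L[ℝ] Cover) q :=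
    hasFDerivAt_const u q
  have h1 (u : Cover) : HasFDerivAt (fun q => fderiv ℝ ζ q u)
      ((fderiv ℝ (fderiv ℝ ζ) p).flip u) p := by
    refine (hd.hasFDerivAt.clm_apply (hconst u p)).congr_fderiv ?_
    ext; simp
  have h2 := hd.hasFDerivAt.clm_apply hJ
  have h3 := (h1 v).const_mul Complex.I
  -- Differentiate dζ(Jv) = i dζ(v) in the direction `w`. The term in which `J` is differentiated
  -- carries the factor `w 0 = 0`, and symmetry of the second derivative then exchanges `v` and `w`.
  have h4 := (h2.congr_of_eventuallyEq (hol.mono fun q hq => (hq v).symm)).unique h3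
  have h5 := congrArg (fun L : Cover →L[ℝ] ℂ => L w) h4
  rw [(h1 w).fderiv]
  simp [hw] at h5
  simp only [ContinuousLinearMap.flip_apply]
  rw [hsymm, h5, hsymm v w]

lemma holomorphic_mul {D E : Cover → ℂ} {p : Cover} (hD : DifferentiableAt ℝ D p)
    (hE : DifferentiableAt ℝ E p) (h : ∀ v, fderiv ℝ D p (J p v) = Complex.I * fderiv ℝ D p v)
    (h' : ∀ v, fderiv ℝ E p (J p v) = Complex.I * fderiv ℝ E p v) (v : Cover) :
    fderiv ℝ (fun q => D q * E q) p (J p v) =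
      Complex.I * fderiv ℝ (fun q => D q * E q) p v := by
  rw [fderiv_fun_mul hD hE]
  simp [h, h']
  ring

lemma holomorphic_sub {D E : Cover → ℂ} {p : Cover} (hD : DifferentiableAt ℝ D p)
    (hE : DifferentiableAt ℝ E p) (h : ∀ v, fderiv ℝ D p (J p v) = Complex.I * fderiv ℝ D p v)
    (h' : ∀ v, fderiv ℝ E p (J p v) = Complex.I * fderiv ℝ E p v) (v : Cover) :
    fderiv ℝ (fun q => D q - E q) p (J p v) =
      Complex.I * fderiv ℝ (fun q => D q - E q) p v := by
  rw [fderiv_fun_sub hD hE]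
  simp [h, h']
  ring

/-- The Jacobian determinant of a holomorphic chart with respect to `y + i x` and
`w + i z - x² / 2`. -/
def chartJac (c : HolomorphicChart) (q : Cover) : ℂ :=
  fderiv ℝ (c.ζ 0) q (cvec 1) * fderiv ℝ (c.ζ 1) q (cvec 3)
    - fderiv ℝ (c.ζ 0) q (cvec 3) * fderiv ℝ (c.ζ 1) q (cvec 1)

/-! ### The determinant of the metric in a holomorphic chart -/

namespace HolomorphicChart

variable (c : HolomorphicChart) {q : Cover}

lemma contDiffAt (hq : q ∈ c.source) (a : Fin 2) : ContDiffAt ℝ ∞ (c.ζ a) q :=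
  (c.smooth a).contDiffAt (c.isOpen_source.mem_nhds hq)

lemma contDiffAt_fderiv (hq : q ∈ c.source) (a : Fin 2) (w : Cover) :
    ContDiffAt ℝ ∞ (fun r => fderiv ℝ (c.ζ a) r w) q :=
  ((c.contDiffAt hq a).fderiv_right (by simp)).clm_apply contDiffAt_const

lemma contDiffAt_chartJac (hq : q ∈ c.source) : ContDiffAt ℝ ∞ (chartJac c) q :=
  ((c.contDiffAt_fderiv hq 0 _).mul (c.contDiffAt_fderiv hq 1 _)).sub
    ((c.contDiffAt_fderiv hq 0 _).mul (c.contDiffAt_fderiv hq 1 _))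

lemma holomorphic_chartJac (hq : q ∈ c.source) (v : Cover) :
    fderiv ℝ (chartJac c) q (J q v) = Complex.I * fderiv ℝ (chartJac c) q v := by
  have hd (a : Fin 2) (w : Cover) : DifferentiableAt ℝ (fun r => fderiv ℝ (c.ζ a) r w) q :=
    (c.contDiffAt_fderiv hq a w).differentiableAt (by simp)
  have hol (a : Fin 2) {w : Cover} (hw : w 0 = 0) := holomorphic_fderiv_const (w := w)
    ((c.contDiffAt hq a).of_le two_le_infty)
    (Filter.eventually_of_mem (c.isOpen_source.mem_nhds hq) (c.holomorphic a)) hw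
  have h1 : cvec 1 0 = 0 := by simp [cvec]
  have h3 : cvec 3 0 = 0 := by simp [cvec]
  exact holomorphic_sub ((hd 0 _).mul (hd 1 _)) ((hd 0 _).mul (hd 1 _))
    (holomorphic_mul (hd 0 _) (hd 1 _) (hol 0 h1) (hol 1 h3))
    (holomorphic_mul (hd 0 _) (hd 1 _) (hol 0 h3) (hol 1 h1)) v

/-- A complex linear functional is determined by its values on ∂_y and ∂_w. The coefficients are the
differentials of y + ix and w + iz - x²/2. -/
lemma fderiv_eq (hq : q ∈ c.source) (a : Fin 2) (v : Cover) :
    fderiv ℝ (c.ζ a) q v = (v 1 + v 0 * Complex.I) * fderiv ℝ (c.ζ a) q (cvec 1)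
      + ((v 3 - q 0 * v 0 : ℝ) + v 2 * Complex.I) * fderiv ℝ (c.ζ a) q (cvec 3) := by
  have h1 := c.holomorphic a q hq (cvec 1)
  have h3 := c.holomorphic a q hq (cvec 3)
  have e1 : J q (cvec 1) = cvec 0 + q 0 • cvec 3 := by
    ext i; fin_cases i <;> simp [cvec]
  have e3 : J q (cvec 3) = cvec 2 := by
    ext i; fin_cases i <;> simp [cvec]
  rw [e1, map_add, map_smul] at h1
  rw [e3] at h3
  rw [← eq_sub_iff_add_eq] at h1
  conv_lhs => rw [cover_eq_sum v]
  simp only [map_add, map_smul, h1, h3, Complex.real_smul]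
  push_cast
  ring

/-- The Jacobian determinant of the inverse change of coordinates. -/
lemma chartJac_mul (hq : q ∈ c.source) :
    chartJac c q * (((c.X 0 q 1 : ℂ) + c.X 0 q 0 * Complex.I)
        * ((c.X 1 q 3 - q 0 * c.X 1 q 0 : ℝ) + c.X 1 q 2 * Complex.I)
      - ((c.X 1 q 1 : ℂ) + c.X 1 q 0 * Complex.I)
        * ((c.X 0 q 3 - q 0 * c.X 0 q 0 : ℝ) + c.X 0 q 2 * Complex.I)) = 1 := by
  -- Duality says that the Jacobian matrix times the matrix of components of the `X b` is the
  -- identity; the claim is the product of determinants.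
  have h (a b : Fin 2) := (c.fderiv_eq hq a (c.X b q)).symm.trans (c.dual a b q hq)
  have h00 := h 0 0
  have h01 := h 0 1
  have h10 := h 1 0
  have h11 := h 1 1
  simp only [zero_ne_one, one_ne_zero, if_true, if_false] at h00 h01 h10 h11
  rw [chartJac]
  have h2 := congrArg₂ (fun z w : ℂ => z * w) h00 h11
  have h3 := congrArg₂ (fun z w : ℂ => z * w) h01 h10
  beta_reduce at h2 h3
  linear_combination h2 - h3

/-- In the coordinates y + ix, w + iz - x²/2 the determinant is φ/4, the 4 coming from the factor
1/2 in each entry. A change of chart multiplies it by the squared modulus of the inverse Jacobian.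
-/
lemma det_hermMat (hf : IsSmoothXY f) (hq : q ∈ c.source) :
    (hermMat (potForm f) c q).det.re =
      conf f q / 4 / Complex.normSq (chartJac c q) := by
  have h1 := c.chartJac_mul hq
  have hne : Complex.normSq (chartJac c q) ≠ 0 := by
    intro h
    rw [Complex.normSq_eq_zero.1 h, zero_mul] at h1
    exact zero_ne_one h1
  have h2 := congrArg Complex.normSq h1
  rw [map_mul, map_one] at h2
  rw [eq_div_iff hne, Matrix.det_fin_two]
  have h3 : ((hermMat (potForm f) c q 0 0 * hermMat (potForm f) c q 1 1
      - hermMat (potForm f) c q 0 1 * hermMat (potForm f) c q 1 0).re) = conf f q / 4 *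
      Complex.normSq (((c.X 0 q 1 : ℂ) + c.X 0 q 0 * Complex.I)
        * ((c.X 1 q 3 - q 0 * c.X 1 q 0 : ℝ) + c.X 1 q 2 * Complex.I)
      - ((c.X 1 q 1 : ℂ) + c.X 1 q 0 * Complex.I)
        * ((c.X 0 q 3 - q 0 * c.X 0 q 0 : ℝ) + c.X 0 q 2 * Complex.I)) := by
    simp only [hermMat, Matrix.of_apply, metric_potForm hf, J_apply_zero, J_apply_one,
      J_apply_two, J_apply_three, Complex.normSq_apply]
    generalize c.X 0 q = X
    generalize c.X 1 q = Y
    simp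
    ring
  rw [h3]
  linear_combination conf f q / 4 * h2

end HolomorphicChart

lemma ddc_log_det_hermMat (hf : IsSmoothXY f) (hpos : ∀ p, 0 < conf f p) (c : HolomorphicChart)
    {p : Cover} (hp : p ∈ c.source) :
    ddc (fun q => Real.log (hermMat (potForm f) c q).det.re) p =
      lap (fun q => Real.log (conf f q)) p • wedge e1 e2 p := by
  have hne {q : Cover} (hq : q ∈ c.source) : chartJac c q ≠ 0 := fun h => by
    have := c.chartJac_mul hq
    rw [h, zero_mul] at this
    exact zero_ne_one this
  have hl := hf.conf.log fun q => (hpos q).ne'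
  have hu := hl.sub (IsSmoothXY.const (Real.log 4))
  have hn : ContDiffAt ℝ 2 (fun q => Real.log (Complex.normSq (chartJac c q))) p := by
    have h1 : ContDiffAt ℝ 2 (fun q => ‖chartJac c q‖ ^ 2) p :=
      ((c.contDiffAt_chartJac hp).of_le two_le_infty).norm_sq ℝ
    simp only [Complex.normSq_eq_norm_sq]
    exact h1.log (pow_ne_zero _ (norm_ne_zero_iff.2 (hne hp)))
  have hev : (fun q => Real.log (hermMat (potForm f) c q).det.re) =ᶠ[nhds p] fun q =>
      (Real.log (conf f q) - Real.log 4) - Real.log (Complex.normSq (chartJac c q)) := by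
    filter_upwards [c.isOpen_source.mem_nhds hp] with q hq
    rw [c.det_hermMat hf hq, Real.log_div (by have := hpos q; positivity)
      (by simpa using hne hq), Real.log_div (hpos q).ne' (by norm_num)]
  rw [ddc_congr hev, ddc_sub (hu.contDiff.contDiffAt.of_le two_le_infty) hn,
    ddc_log_normSq_eq_zero ((c.contDiffAt_chartJac hp).of_le two_le_infty)
      (Filter.eventually_of_mem (c.isOpen_source.mem_nhds hp) fun q hq => c.holomorphic_chartJac hq)
      (hne hp), sub_zero, ddc_eq_lap hu]
  congr 1
  have h (i : Fin 4) : pd i (fun q => Real.log (conf f q) - Real.log 4) =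
      pd i (fun q => Real.log (conf f q)) := by
    funext q
    rw [pd_sub i (hl.differentiable q) (differentiableAt_const _), pd_const, sub_zero]
  simp only [lap, h]

/-! ## Deformations of type II -/

/-- Since |e³| = 1, this is the expansion of (-e³ + df) ∧ (-e⁴ + J df), with e¹² - dd^c f = φ e¹².
-/
lemma deformedForm_eq_potForm (hf : IsSmoothXY f) :
    deformedForm omega0 (-e3) f = potForm f := by
  have h0 (p : Cover) : normSq omega0 (-e3) p = 1 := by
    rw [omega0_eq_potForm, neg_e3_eq_leeForm]
    exact normSq_leeForm isSmoothXY_zero (fun p => by rw [conf_zero]; exact one_pos) p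
  funext p
  refine form_two_ext fun u v => ?_
  have he (v : Cover) : (-e3) p ![v] = -v 3 := rfl
  rw [deformedForm, h0, ddc_eq_lap hf, potForm_apply hf]
  simp only [ContinuousAlternatingMap.add_apply, ContinuousAlternatingMap.sub_apply,
    ContinuousAlternatingMap.smul_apply, smul_eq_mul, omega0, Pi.add_apply, wedge_one_apply,
    Jform_apply, dfun_apply, hf.fderiv_apply, he, e1_apply, e2_apply, e3_apply, e4_apply,
    J_apply_zero, J_apply_one, J_apply_three, lap, conf]
  ring

lemma potForm_eq (hf : IsSmoothXY f) (p : Cover) : potForm f p =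
    (1 + pd 0 f p ^ 2 + pd 1 f p ^ 2 - pd 0 (pd 0 f) p - pd 1 (pd 1 f) p) • wedge e1 e2 p
      + wedge e3 e4 p
      - pd 0 f p • (wedge e1 e3 p + wedge e2 e4 p)
      - pd 1 f p • (wedge e1 e4 p - wedge e2 e3 p) := by
  refine form_two_ext fun u v => ?_
  rw [potForm_apply hf]
  simp only [ContinuousAlternatingMap.add_apply, ContinuousAlternatingMap.sub_apply,
    ContinuousAlternatingMap.smul_apply, smul_eq_mul, wedge_one_apply, e1_apply, e2_apply,
    e3_apply, e4_apply, conf]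
  ring

lemma leeForm_eq (hf : IsSmoothXY f) (p : Cover) :
    leeForm f p = -e3 p + pd 1 f p • e1 p + pd 0 f p • e2 p := by
  refine form_one_ext fun u => ?_
  rw [leeForm_apply hf]
  simp only [ContinuousAlternatingMap.add_apply, ContinuousAlternatingMap.neg_apply,
    ContinuousAlternatingMap.smul_apply, smul_eq_mul, e1_apply, e2_apply, e3_apply]
  ring

lemma isNormalizedVaisman_omega0 : IsNormalizedVaisman omega0 (-e3) := by
  rw [omega0_eq_potForm, neg_e3_eq_leeForm]
  exact isNormalizedVaisman_potForm isSmoothXY_zero (fun _ _ _ _ _ => rfl)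
    fun p => by rw [conf_zero]; exact one_pos

lemma isTypeIIDeformation_potForm (hf : IsAdmissible f) :
    IsTypeIIDeformation omega0 (-e3) f (potForm f) (leeForm f) := by
  have hs := isSmoothXY_of_isAdmissible hf
  have hT (p : Cover) : sharp omega0 (-e3) p = -cvec 3 := by
    rw [omega0_eq_potForm, neg_e3_eq_leeForm]
    exact sharp_leeForm isSmoothXY_zero (fun p => by rw [conf_zero]; exact one_pos) p
  exact
    { isVaisman := isNormalizedVaisman_omega0.1
      isFunctionOnM := hf.isFunctionOnM
      T_apply := fun p => by
        rw [hT]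
        exact hs.fderiv_apply_eq_zero p _ (by simp [cvec]) (by simp [cvec])
      JT_apply := fun p => by
        rw [hT]
        exact hs.fderiv_apply_eq_zero p _ (by simp [cvec]) (by simp [cvec])
      form_eq := (deformedForm_eq_potForm hs).symm
      lee_eq := rfl
      positive := isFundamentalForm_potForm hs hf.isFunctionOnM.2 hf.lap_lt }

lemma hFun_eq (f : Cover → ℝ) (p : Cover) :
    hFun f p = 1 / 2 * lap (fun q => Real.log (conf f q)) p / conf f p := by
  have h : -1 + pd 0 (pd 0 f) p + pd 1 (pd 1 f) p = -conf f p := by rw [conf]; ring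
  rw [hFun, h, one_div_neg_eq_neg_one_div]
  simp only [conf]
  ring

lemma scalarCurvature_eq_hFun (hf : IsSmoothXY f) (hpos : ∀ p, 0 < conf f p) (p : Cover) :
    scalarCurvature (potForm f) p = -2 * hFun f p - 1 / 2 := by
  rw [scalarCurvature_potForm hf hpos, hFun_eq]
  ring

lemma isNonconstant_scalarCurvature (hf : IsAdmissible f) (h : IsNonconstant (hFun f)) :
    IsNonconstant (scalarCurvature (potForm f)) := by
  obtain ⟨p, q, hpq⟩ := h
  have hs := isSmoothXY_of_isAdmissible hf
  refine ⟨p, q, fun h' => hpq ?_⟩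
  rw [scalarCurvature_eq_hFun hs hf.lap_lt, scalarCurvature_eq_hFun hs hf.lap_lt] at h'
  linarith

lemma isChernRicciForm_potForm (hf : IsSmoothXY f) (hpos : ∀ p, 0 < conf f p) :
    IsChernRicciForm (potForm f) fun p =>
      (-(1 / 2) * lap (fun q => Real.log (conf f q)) p) • wedge e1 e2 p := fun c p hp => by
  rw [ddc_log_det_hermMat hf hpos c hp, smul_smul]

/-! ## An explicit example -/

/-- A potential depending only on `x`, with `1 - f_xx = 1 + cos (2πx) / 2`. -/
def examplePot (p : Cover) : ℝ := 1 / (8 * Real.pi ^ 2) * Real.cos (2 * Real.pi * p 0)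

lemma hasFDerivAt_comp_coord_zero {φ : ℝ → ℝ} {φ' : ℝ} {p : Cover} (h : HasDerivAt φ φ' (p 0)) :
    HasFDerivAt (fun q : Cover => φ (q 0)) (φ' • dcoord 0) p :=
  h.comp_hasFDerivAt p (dcoord 0).hasFDerivAt

lemma pd_comp_coord_zero {φ φ' : ℝ → ℝ} (h : ∀ x, HasDerivAt φ (φ' x) x) (i : Fin 4) :
    pd i (fun q => φ (q 0)) = fun q => φ' (q 0) * cvec i 0 := by
  funext p
  rw [pd, (hasFDerivAt_comp_coord_zero (h (p 0))).fderiv]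
  simp

lemma hasDerivAt_cos_mul (A k x : ℝ) :
    HasDerivAt (fun x => A * Real.cos (k * x)) (-(A * k) * Real.sin (k * x)) x := by
  have h := (((hasDerivAt_id x).const_mul k).cos).const_mul A
  refine h.congr_deriv ?_
  simp; ring

lemma hasDerivAt_sin_mul (A k x : ℝ) :
    HasDerivAt (fun x => A * Real.sin (k * x)) (A * k * Real.cos (k * x)) x := by
  have h := (((hasDerivAt_id x).const_mul k).sin).const_mul A
  refine h.congr_deriv ?_
  simp; ring

lemma conf_examplePot (p : Cover) :
    conf examplePot p = 1 + 1 / 2 * Real.cos (2 * Real.pi * p 0) := by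
  have hpi := Real.pi_ne_zero
  have h (i : Fin 4) := pd_comp_coord_zero
    (hasDerivAt_cos_mul (1 / (8 * Real.pi ^ 2)) (2 * Real.pi)) i
  have h0 : pd 0 examplePot = fun q =>
      -(1 / (8 * Real.pi ^ 2) * (2 * Real.pi)) * Real.sin (2 * Real.pi * q 0) :=
    (h 0).trans (by simp [cvec])
  have h1 : pd 1 examplePot = fun _ => 0 := (h 1).trans (by simp [cvec])
  rw [conf, h0, h1, pd_comp_coord_zero (hasDerivAt_sin_mul _ _) 0, pd_const]
  simp only [cvec, Pi.single_eq_same, mul_one]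
  -- The constant 1/(8π²) is (1/2)/(2π)², so two derivatives leave amplitude 1/2.
  field_simp
  ring

lemma conf_examplePot_pos (p : Cover) : 0 < conf examplePot p := by
  rw [conf_examplePot]
  linarith [Real.neg_one_le_cos (2 * Real.pi * p 0)]

lemma isAdmissible_examplePot : IsAdmissible examplePot where
  isFunctionOnM := by
    refine ⟨contDiff_const.mul (Real.contDiff_cos.comp
      (contDiff_const.mul (contDiff_coord 0))), fun j k m n p => ?_⟩
    have h : 2 * Real.pi * deck j k m n p 0 = 2 * Real.pi * p 0 + j * (2 * Real.pi) := by
      simp [deck]; ring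
    rw [examplePot, h, Real.cos_add_int_mul_two_pi, examplePot]
  dependsOnlyOnXY p q h _ := by rw [examplePot, h, examplePot]
  lap_lt := conf_examplePot_pos

lemma lap_log_conf_examplePot (p : Cover) :
    lap (fun q => Real.log (conf examplePot q)) p =
      -2 * Real.pi ^ 2 * (Real.cos (2 * Real.pi * p 0) + 1 / 2)
        / (1 + 1 / 2 * Real.cos (2 * Real.pi * p 0)) ^ 2 := by
  have hpos (x : ℝ) : 1 + 1 / 2 * Real.cos (2 * Real.pi * x) ≠ 0 := by
    linarith [Real.neg_one_le_cos (2 * Real.pi * x)]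
  have hd (x : ℝ) : HasDerivAt (fun x => 1 + 1 / 2 * Real.cos (2 * Real.pi * x))
      (-(1 / 2 * (2 * Real.pi)) * Real.sin (2 * Real.pi * x)) x :=
    (hasDerivAt_cos_mul (1 / 2) (2 * Real.pi) x).const_add 1
  have h (i : Fin 4) := pd_comp_coord_zero (fun x => (hd x).log (hpos x)) i
  have h0 : pd 0 (fun q => Real.log (conf examplePot q)) = fun q =>
      (-(1 / 2 * (2 * Real.pi)) * Real.sin (2 * Real.pi * q 0))
        / (1 + 1 / 2 * Real.cos (2 * Real.pi * q 0)) := by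
    simp only [conf_examplePot]
    exact (h 0).trans (by simp [cvec])
  have h1 : pd 1 (fun q => Real.log (conf examplePot q)) = fun _ => 0 := by
    simp only [conf_examplePot]
    exact (h 1).trans (by simp [cvec])
  have h2 := congrFun (pd_comp_coord_zero (φ := fun x =>
    (-(1 / 2 * (2 * Real.pi)) * Real.sin (2 * Real.pi * x))
      / (1 + 1 / 2 * Real.cos (2 * Real.pi * x)))
    (fun x => (hasDerivAt_sin_mul _ _ x).div (hd x) (hpos x)) 0) p
  rw [lap, h0, h1, pd_const, h2]
  have hsq := Real.sin_sq_add_cos_sq (2 * Real.pi * p 0)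
  simp only [cvec, Pi.single_eq_same, mul_one, add_zero]
  congr 1
  -- The numerator of (log φ)'' is φ''φ - φ'², in which sin² + cos² = 1 removes the squares.
  linear_combination -Real.pi ^ 2 * hsq

lemma isNonconstant_hFun_examplePot : IsNonconstant (hFun examplePot) := by
  -- At x = 0 and x = 1/2 the cosine is 1 and -1, and h has opposite signs: -4π²/9 and 4π².
  refine ⟨0, fun _ => 1 / 2, ?_⟩
  have h : 2 * Real.pi * (1 / 2) = Real.pi := by ring
  rw [hFun_eq, hFun_eq, lap_log_conf_examplePot, lap_log_conf_examplePot, conf_examplePot,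
    conf_examplePot, h, Pi.zero_apply, mul_zero, Real.cos_zero, Real.cos_pi]
  have hp : 0 < Real.pi ^ 2 := by positivity
  intro h'
  norm_num at h'
  linarith

end KodairaThurston

end

/-! ### The main theorem -/

open KodairaThurston in
theorem mainTheorem4 :
    -- the initial Vaisman structure
    (IsNormalizedVaisman omega0 (-e3) ∧ IsT2Invariant omega0) ∧
    -- its deformations of type II by functions of `x, y`
    (∀ f : Cover → ℝ, IsAdmissible f →
      ∀ (ω : Form 2) (θ : Form 1), ω = deformedForm omega0 (-e3) f → θ = deformedLee (-e3) f →
        IsTypeIIDeformation omega0 (-e3) f ω θ ∧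
        (∀ p, ω p =
          (1 + pd 0 f p ^ 2 + pd 1 f p ^ 2 - pd 0 (pd 0 f) p - pd 1 (pd 1 f) p) • wedge e1 e2 p
            + wedge e3 e4 p
            - pd 0 f p • (wedge e1 e3 p + wedge e2 e4 p)
            - pd 1 f p • (wedge e1 e4 p - wedge e2 e3 p)) ∧
        (∀ p, θ p = -e3 p + pd 1 f p • e1 p + pd 0 f p • e2 p) ∧
        IsNormalizedVaisman ω θ ∧
        IsT2Invariant ω ∧
        (∀ p, extDeriv (Jform θ) p =
          (-1 + pd 0 (pd 0 f) p + pd 1 (pd 1 f) p) • wedge e1 e2 p) ∧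
        IsChernRicciForm ω (fun p => (-(1 / 2) *
          lap (fun q => Real.log (1 - pd 0 (pd 0 f) q - pd 1 (pd 1 f) q)) p) • wedge e1 e2 p) ∧
        IsChernRicciForm ω (fun p => hFun f p • extDeriv (Jform θ) p) ∧
        (IsNonconstant (hFun f) → IsNonconstant (scalarCurvature ω))) ∧
    -- suitable `f` exist
    (∃ f : Cover → ℝ, IsAdmissible f ∧ IsNonconstant (hFun f)) ∧
    -- Vaisman metrics with non-constant scalar curvature exist
    (∃ (ω : Form 2) (θ : Form 1), IsVaisman ω θ ∧ IsT2Invariant ω ∧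
      IsNonconstant (scalarCurvature ω)) := by
  refine ⟨⟨isNormalizedVaisman_omega0, ?_⟩, ?_,
    ⟨examplePot, isAdmissible_examplePot, isNonconstant_hFun_examplePot⟩,
    ⟨potForm examplePot, leeForm examplePot, ?_, ?_, ?_⟩⟩
  · rw [omega0_eq_potForm]
    exact isT2Invariant_potForm isSmoothXY_zero
  · intro f hf ω θ hω hθ
    have hs := isSmoothXY_of_isAdmissible hf
    rw [deformedForm_eq_potForm hs] at hω
    subst hω hθ
    have hd (p : Cover) : extDeriv (Jform (leeForm f)) p =
        (-1 + pd 0 (pd 0 f) p + pd 1 (pd 1 f) p) • wedge e1 e2 p := by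
      rw [extDeriv_Jform_leeForm hs, conf]
      congr 1
      ring
    have hρ := isChernRicciForm_potForm hs hf.lap_lt
    refine ⟨isTypeIIDeformation_potForm hf, potForm_eq hs, leeForm_eq hs,
      isNormalizedVaisman_potForm hs hf.isFunctionOnM.2 hf.lap_lt, isT2Invariant_potForm hs,
      hd, hρ, ?_, isNonconstant_scalarCurvature hf⟩
    -- With h = Δ log φ / (2φ) and d(Jθ) = -φ e¹², the factor φ cancels.
    have h : (fun p => hFun f p • extDeriv (Jform (leeForm f)) p) = fun p =>
        (-(1 / 2) * lap (fun q => Real.log (conf f q)) p) • wedge e1 e2 p := by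
      funext p
      rw [extDeriv_Jform_leeForm hs, smul_smul, hFun_eq]
      congr 1
      have : conf f p ≠ 0 := (hf.lap_lt p).ne'
      field_simp
    rw [h]
    exact hρ
  · exact (isNormalizedVaisman_potForm (isSmoothXY_of_isAdmissible isAdmissible_examplePot)
      isAdmissible_examplePot.isFunctionOnM.2 conf_examplePot_pos).1
  · exact isT2Invariant_potForm (isSmoothXY_of_isAdmissible isAdmissible_examplePot)
  · exact isNonconstant_scalarCurvature isAdmissible_examplePot isNonconstant_hFun_examplePot
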